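/- **Lemma (Concentration of the target posterior).** Let $\mathcal A$ be a set of arms. For every arm $a$ let $\{p_a(\cdot\mid\theta)\}_{\theta\in\mathbb R^{d_a}}$ be a family of everywhere positive probability densities on $\mathbb R$, let $\theta_a^*\in\mathbb R^{d_a}$ be the true parameter, and let $m_a,\nu_a>0$ and $L_a$ be real constants such that $\log p_a(X\mid\theta)$ is differentiable in $\theta$ and in $X$ and, for all $X,X'\in\mathbb R$ and $\theta,\theta'\in\mathbb R^{d_a}$: 1. $\langle\nabla_\theta\log p_a(X\mid\theta)-\nabla_\theta\log p_a(X\mid\theta'),\,\theta-\theta'\rangle\le -m_a\|\theta-\theta'\|^2$; 2. $\big(\nabla_X\log p_a(X\mid\theta)-\nabla_X\log p_a(X'\mid\theta)\big)(X-X')\le-\nu_a|X-X'|^2$; 3. $\|\nabla_\theta\log p_a(X\mid\theta)-\nabla_\theta\log p_a(X'\mid\theta')\|\le L_a\big(|X-X'|+\|\theta-\theta'\|\big)$. Here $\|\cdot\|$ is the Euclidean norm. Let $T\ge 1$ be an integer and let $X_1,\dots,X_T$ be i.i.d. with density $p_a(\cdot\mid\theta_a^*)$. Then for every arm $a$ the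 target posterior $$\mu_a^{\mathrm{SA}}(d\theta)\ \propto\ \exp\Big(\sum_{i=1}^T\log p_a(X_i\mid\theta)\Big)\,d\theta$$ is, for every value of the data, a well-defined probability measure on $\mathbb R^{d_a}$ that depends measurably on the data, and, with $\mathbb E$ and $\mathbb P$ taken jointly over the data $X_1,\dots,X_T$ and $\theta\sim\mu_a^{\mathrm{SA}}$, for every real $p\ge 1$ $$\mathbb E\big[\|\theta-\theta_a^*\|^p\big]^{1/p}\le\sqrt{\frac{8d_a}{m_aT}+\Big(\frac{2L_a^2d_a}{m_a^2\nu_aT}+\frac{64}{m_aT}\Big)p}$$ and $$\mathbb E\big[\|\theta-\theta_a^*\|^p\big]^{1/p}\le\sqrt{\frac{2}{m_aT}\Big(4d_a+(\kappa_a^2d_a+32)\,p\Big)},\qquad \kappa_a=\max\Big\{\frac{L_a}{m_a},\frac{L_a}{\nu_a}\Big\}.$$ Moreover $\|\theta-\theta_a^*\|$ has sub-Gaussian tails: there is $K>0$ such that $\mathbb P\big(\|\theta-\theta_a^*\|\ge t\big)\le 2\exp(-t^2/K^2)$ for all $t\ge 0$. -/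

import Mathlib

open MeasureTheory

noncomputable section

/-- A parametric family `p(x | θ)` of everywhere positive probability densities on `ℝ`,
`p x θ` being the density of the reward `x` under the parameter `θ ∈ ℝᵈ`. -/
structure IsDensityFamily {d : ℕ} (p : ℝ → EuclideanSpace ℝ (Fin d) → ℝ) : Prop where
  pos : ∀ x θ, 0 < p x θ
  lintegral_eq_one : ∀ θ, ∫⁻ x, ENNReal.ofReal (p x θ) = 1

/-- `∇_θ log p(x | θ)`. -/
def gradParam {d : ℕ} (p : ℝ → EuclideanSpace ℝ (Fin d) → ℝ)
    (x : ℝ) (θ : EuclideanSpace ℝ (Fin d)) : EuclideanSpace ℝ (Fin d) :=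
  gradient (fun ϑ => Real.log (p x ϑ)) θ

/-- `∇_x log p(x | θ)`. -/
def gradReward {d : ℕ} (p : ℝ → EuclideanSpace ℝ (Fin d) → ℝ)
    (x : ℝ) (θ : EuclideanSpace ℝ (Fin d)) : ℝ :=
  deriv (fun y => Real.log (p y θ)) x

/-- `m`-strong log-concavity of `p(x | θ)` over the parameter `θ`. -/
structure StronglyLogConcaveParam {d : ℕ} (p : ℝ → EuclideanSpace ℝ (Fin d) → ℝ)
    (m : ℝ) : Prop where
  differentiable : ∀ x, Differentiable ℝ (fun θ => Real.log (p x θ))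
  inner_le : ∀ x θ θ',
    inner ℝ (gradParam p x θ - gradParam p x θ') (θ - θ') ≤ -m * ‖θ - θ'‖ ^ 2

/-- `ν`-strong log-concavity of `p(x | θ)` over the reward `x`. -/
structure StronglyLogConcaveReward {d : ℕ} (p : ℝ → EuclideanSpace ℝ (Fin d) → ℝ)
    (ν : ℝ) : Prop where
  differentiable : ∀ θ, Differentiable ℝ (fun x => Real.log (p x θ))
  mul_le : ∀ x x' θ,
    (gradReward p x θ - gradReward p x' θ) * (x - x') ≤ -ν * |x - x'| ^ 2

/-- Joint `L`-Lipschitz continuity of `∇_θ log p(x | θ)` in `(x, θ)`. -/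
def JointLipschitzGrad {d : ℕ} (p : ℝ → EuclideanSpace ℝ (Fin d) → ℝ) (L : ℝ) : Prop :=
  ∀ x x' θ θ', ‖gradParam p x θ - gradParam p x' θ'‖ ≤ L * (|x - x'| + ‖θ - θ'‖)

/-- The law on `ℝ` with density `p(· | θ)`. -/
def rewardLaw {d : ℕ} (p : ℝ → EuclideanSpace ℝ (Fin d) → ℝ)
    (θ : EuclideanSpace ℝ (Fin d)) : Measure ℝ :=
  volume.withDensity (fun x => ENNReal.ofReal (p x θ))

/-- The law of `T` i.i.d. rewards `X₁, …, X_T ∼ p(· | θ)`. -/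
def dataLaw {d : ℕ} (p : ℝ → EuclideanSpace ℝ (Fin d) → ℝ)
    (θ : EuclideanSpace ℝ (Fin d)) (T : ℕ) : Measure (Fin T → ℝ) :=
  Measure.pi (fun _ => rewardLaw p θ)

/-- The target posterior given the data `X`: the probability measure on `ℝᵈ` whose Lebesgue
density is proportional to `θ ↦ exp (∑ i, log p(X i | θ))`. -/
def targetPosterior {d T : ℕ} (p : ℝ → EuclideanSpace ℝ (Fin d) → ℝ)
    (X : Fin T → ℝ) : Measure (EuclideanSpace ℝ (Fin d)) :=
  volume.tilted (fun θ => ∑ i, Real.log (p (X i) θ))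

/-- The law of `θ` when first the data `X` are drawn i.i.d. from `p(· | θstar)` and then,
given `X`, `θ` is drawn from the target posterior. -/
def posteriorLaw {d : ℕ} (p : ℝ → EuclideanSpace ℝ (Fin d) → ℝ)
    (θstar : EuclideanSpace ℝ (Fin d)) (T : ℕ) : Measure (EuclideanSpace ℝ (Fin d)) :=
  (dataLaw p θstar T).bind (fun X => targetPosterior p X)

/-- The nonnegative random variable `Z` has sub-Gaussian tails under `P`. -/
def HasSubGaussianTails {Ω : Type*} [MeasurableSpace Ω] (P : Measure Ω) (Z : Ω → ℝ) : Prop :=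
  ∃ K : ℝ, 0 < K ∧ ∀ t : ℝ, 0 ≤ t →
    P {ω | t ≤ Z ω} ≤ ENNReal.ofReal (2 * Real.exp (-t ^ 2 / K ^ 2))

end

/-! Fix the data. The log-posterior is `m T`-strongly concave and its gradient at the true parameter
is the sample score `S`. Dilating about the true parameter gives `M E‖y‖^q ≤ (d + q - 2) E‖y‖^(q-2)
+ ‖S‖ E‖y‖^(q-1)` with `M = m T` (`moment_recursion`). By Lyapunov's inequality this is a quadratic
inequality for the `L^q` norm, whose square is at most `2 (d + q - 2) / M + ‖S‖² / M²`
(`lintegral_rpow_norm_tilted_le`).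

It remains to average `‖S‖²` over the data. Each coordinate of `S` is a sum of independent terms,
each an `L`-Lipschitz function of one reward and centred because a score has mean zero.
Sub-Gaussianity comes from symmetrization: for two independent rewards with fixed midpoint, the
difference `D` has an even weight which is a Gaussian of variance `2 / ν` times a radially
decreasing factor. As `cosh (s D)` is radially increasing, Chebyshev's association inequality bounds
its mean by the Gaussian value `exp (s² / ν)` (`lintegral_lintegral_cosh_sub_le`); Lipschitz
functions inherit the bound. The moments of the coordinates follow, and Minkowski's inequality sums
their squares.

The `κ` bound is a weakening of the first one, and moments of order `√q` give the tails through
Markov's inequality. -/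

open ProbabilityTheory ENNReal NNReal Filter Topology

/-! ### Sub-Gaussian differences for strongly log-concave laws on the line -/

/-- Chebyshev's association inequality. -/
theorem lintegral_mul_le_of_antivary {α : Type*} [MeasurableSpace α] (μ : Measure α)
    [IsProbabilityMeasure μ] {f w : α → ℝ≥0∞} (hf : Measurable f) (hw : Measurable w)
    (h : Antivary w f) : ∫⁻ x, f x * w x ∂μ ≤ (∫⁻ x, f x ∂μ) * ∫⁻ x, w x ∂μ := by
  -- This is `(f y - f z) * (w y - w z) ≤ 0` rearranged without subtraction; integrating over two
  -- independent copies yields twice the claim.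
  have key : ∀ y z, f y * w y + f z * w z ≤ f y * w z + f z * w y := by
    have aux : ∀ y z, f y < f z → f y * w y + f z * w z ≤ f y * w z + f z * w y := by
      intro y z hyz
      obtain ⟨a, ha⟩ := exists_add_of_le hyz.le
      obtain ⟨b, hb⟩ := exists_add_of_le (h hyz)
      rw [ha, hb]
      calc f y * (w z + b) + (f y + a) * w z ≤ f y * (w z + b) + (f y + a) * w z + a * b :=
            le_self_add
        _ = f y * w z + (f y + a) * (w z + b) := by ring
    intro y z
    rcases lt_trichotomy (f y) (f z) with hyz | hyz | hyz
    · exact aux y z hyz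
    · rw [hyz, add_comm]
    · have := aux z y hyz
      rwa [add_comm, add_comm (f y * w z)]
  have hfw : Measurable fun x => f x * w x := hf.mul hw
  have h2 : ∫⁻ y, ∫⁻ z, (f y * w y + f z * w z) ∂μ ∂μ
      ≤ ∫⁻ y, ∫⁻ z, (f y * w z + f z * w y) ∂μ ∂μ :=
    lintegral_mono fun y => lintegral_mono fun z => key y z
  have hl : ∫⁻ y, ∫⁻ z, (f y * w y + f z * w z) ∂μ ∂μ = 2 * ∫⁻ x, f x * w x ∂μ := by
    simp_rw [lintegral_add_left measurable_const, lintegral_const, measure_univ, mul_one]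
    rw [lintegral_add_left hfw, lintegral_const, measure_univ, mul_one, two_mul]
  have hr : ∫⁻ y, ∫⁻ z, (f y * w z + f z * w y) ∂μ ∂μ
      = 2 * ((∫⁻ x, f x ∂μ) * ∫⁻ x, w x ∂μ) := by
    simp_rw [lintegral_add_left (hw.const_mul _), lintegral_const_mul _ hw,
      lintegral_mul_const _ hf]
    rw [lintegral_add_left (hf.mul_const _), lintegral_mul_const _ hf, lintegral_const_mul _ hw,
      two_mul]
  rw [hl, hr] at h2
  exact (ENNReal.mul_le_mul_iff_right (by norm_num) (by norm_num)).1 h2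

theorem lintegral_cosh_gaussianReal (v : ℝ≥0) (s : ℝ) :
    ∫⁻ x, ENNReal.ofReal (Real.cosh (s * x)) ∂(gaussianReal 0 v)
      = ENNReal.ofReal (Real.exp (v * s ^ 2 / 2)) := by
  have hi : ∀ t : ℝ, Integrable (fun x => Real.exp (t * x)) (gaussianReal 0 v) :=
    fun t => integrable_exp_mul_gaussianReal t
  have hm : ∀ t : ℝ, ∫ x, Real.exp (t * x) ∂(gaussianReal 0 v) = Real.exp (v * t ^ 2 / 2) := by
    intro t
    have := congrFun (mgf_id_gaussianReal (μ := 0) (v := v)) t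
    simpa [mgf] using this
  have hc : ∀ x : ℝ, Real.cosh (s * x) = (Real.exp (s * x) + Real.exp (-s * x)) / 2 := by
    intro x; rw [Real.cosh_eq, neg_mul]
  simp_rw [hc]
  have hint : Integrable (fun x => (Real.exp (s * x) + Real.exp (-s * x)) / 2)
      (gaussianReal 0 v) := ((hi s).add (hi (-s))).div_const 2
  rw [← ofReal_integral_eq_lintegral_ofReal hint
    (Filter.Eventually.of_forall fun x => by positivity), integral_div,
    integral_add (hi s) (hi (-s)), hm, hm, neg_sq]
  congr 1
  ring

/-- A function which is a centred Gaussian weight times a radially decreasing one is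
sub-Gaussian. -/
theorem lintegral_cosh_mul_exp_le {ψ : ℝ → ℝ} {v : ℝ≥0} (hv : v ≠ 0) (hψ : Measurable ψ)
    (hanti : ∀ y z, |y| ≤ |z| → ψ z + z ^ 2 / (2 * v) ≤ ψ y + y ^ 2 / (2 * v)) (s : ℝ) :
    ∫⁻ y, ENNReal.ofReal (Real.cosh (s * y)) * ENNReal.ofReal (Real.exp (ψ y))
      ≤ ENNReal.ofReal (Real.exp (v * s ^ 2 / 2)) * ∫⁻ y, ENNReal.ofReal (Real.exp (ψ y)) := by
  -- The density of `exp ψ` relative to the Gaussian: radially decreasing by `hanti`, whereas `cosh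
  -- (s * y)` is radially increasing.
  set w : ℝ → ℝ≥0∞ := fun y =>
    ENNReal.ofReal (√(2 * Real.pi * v) * Real.exp (ψ y + y ^ 2 / (2 * v))) with hw
  have hwm : Measurable w := by fun_prop
  have hcm : Measurable fun y : ℝ => ENNReal.ofReal (Real.cosh (s * y)) :=
    (Real.continuous_cosh.measurable.comp (measurable_const_mul s)).ennreal_ofReal
  have hv0 : (0 : ℝ) < v := by positivity
  have hpdf : ∀ y, ENNReal.ofReal (Real.exp (ψ y)) = gaussianPDF 0 v y * w y := by
    intro y
    rw [gaussianPDF, hw, ← ENNReal.ofReal_mul (gaussianPDFReal_nonneg _ _ _), gaussianPDFReal]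
    congr 1
    have : √(2 * Real.pi * v) ≠ 0 := by positivity
    rw [mul_mul_mul_comm, inv_mul_cancel₀ this, one_mul, ← Real.exp_add]
    congr 1
    ring
  have hswap : ∀ f : ℝ → ℝ≥0∞, Measurable f →
      ∫⁻ y, f y * ENNReal.ofReal (Real.exp (ψ y)) = ∫⁻ y, f y * w y ∂(gaussianReal 0 v) := by
    intro f hf
    rw [gaussianReal_of_var_ne_zero _ hv]
    refine Eq.trans ?_ (lintegral_withDensity_eq_lintegral_mul _ (measurable_gaussianPDF 0 v)
      (hf.mul hwm)).symm
    refine lintegral_congr fun y => ?_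
    simp only [Pi.mul_apply]
    rw [hpdf y]
    ring
  have h1 := hswap _ hcm
  have h2 := hswap (fun _ => 1) measurable_const
  simp only [one_mul] at h2
  rw [h1, h2, ← lintegral_cosh_gaussianReal]
  refine lintegral_mul_le_of_antivary _ hcm hwm fun y z hyz => ?_
  have hyz' := (ENNReal.ofReal_lt_ofReal_iff_of_nonneg (Real.cosh_pos _).le).1 hyz
  rw [Real.cosh_lt_cosh, abs_mul, abs_mul] at hyz'
  have := lt_of_mul_lt_mul_left hyz' (abs_nonneg s)
  refine ENNReal.ofReal_le_ofReal ?_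
  have h := hanti y z this.le
  gcongr

/-- Strong concavity makes `D ↦ ℓ (c + D / 2) + ℓ (c - D / 2) + ν D² / 4` radially decreasing. -/
theorem midpoint_add_sq_antitone {l : ℝ → ℝ} {ν : ℝ} (hl : Differentiable ℝ l)
    (hν : ∀ x x', (deriv l x - deriv l x') * (x - x') ≤ -ν * |x - x'| ^ 2) (c : ℝ) {y z : ℝ}
    (hyz : |y| ≤ |z|) :
    l (c + z / 2) + l (c - z / 2) + ν * z ^ 2 / 4
      ≤ l (c + y / 2) + l (c - y / 2) + ν * y ^ 2 / 4 := by
  set F : ℝ → ℝ := fun D => l (c + D / 2) + l (c - D / 2) + ν * D ^ 2 / 4 with hF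
  have hd : ∀ D, HasDerivAt F
      (deriv l (c + D / 2) * (1 / 2) + deriv l (c - D / 2) * (-(1 / 2)) + ν * D / 2) D := by
    intro D
    have h1 : HasDerivAt (fun D : ℝ => c + D / 2) (1 / 2) D :=
      ((hasDerivAt_id D).div_const 2).const_add c
    have h2 : HasDerivAt (fun D : ℝ => c - D / 2) (-(1 / 2)) D :=
      ((hasDerivAt_id D).div_const 2).const_sub c
    have h3 : HasDerivAt (fun D : ℝ => ν * D ^ 2 / 4) (ν * D / 2) D := by
      refine (((hasDerivAt_pow 2 D).const_mul ν).div_const 4).congr_deriv ?_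
      norm_num
      ring
    exact ((HasDerivAt.comp D (hl _).hasDerivAt h1).add
      (HasDerivAt.comp D (hl _).hasDerivAt h2)).add h3
  -- The points `c ± D / 2` are at distance `D`, so strong concavity bounds half the difference of
  -- their derivatives by `-ν D / 2`, cancelling the derivative of `ν D² / 4` exactly. Evenness then
  -- covers negative `D`.
  have hanti : AntitoneOn F (Set.Ici 0) := by
    refine antitoneOn_of_deriv_nonpos (convex_Ici 0)
      (fun D _ => (hd D).continuousAt.continuousWithinAt)
      (fun D _ => (hd D).differentiableAt.differentiableWithinAt) fun D hD => ?_
    rw [interior_Ici, Set.mem_Ioi] at hD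
    rw [(hd D).deriv]
    have h := hν (c + D / 2) (c - D / 2)
    have e : c + D / 2 - (c - D / 2) = D := by ring
    rw [e, sq_abs] at h
    nlinarith
  have hev : ∀ D, F |D| = F D := by
    intro D
    rcases abs_choice D with h | h
    · rw [h]
    · rw [h]
      simp only [hF]
      rw [show c + -D / 2 = c - D / 2 by ring, show c - -D / 2 = c + D / 2 by ring, neg_sq]
      ring
  have := hanti (Set.mem_Ici.2 (abs_nonneg y)) (Set.mem_Ici.2 (abs_nonneg z)) hyz
  rwa [hev, hev] at this

/-- Midpoint and difference are reached by a reflection, a translation and swaps of the order of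
integration, so no Jacobian appears. -/
theorem lintegral_lintegral_midpoint {F : ℝ → ℝ → ℝ≥0∞} (hF : Measurable (Function.uncurry F)) :
    ∫⁻ x, ∫⁻ x', F x x' = ∫⁻ c, ∫⁻ D, F (c + D / 2) (c - D / 2) := by
  have h1 : ∀ x, ∫⁻ x', F x x' = ∫⁻ D, F x (x - D) := fun x =>
    (lintegral_sub_left_eq_self (fun x' => F x x') x).symm
  have h2 : ∀ D, ∫⁻ x, F x (x - D) = ∫⁻ c, F (c + D / 2) (c - D / 2) := fun D => by
    rw [← lintegral_add_right_eq_self (fun x => F x (x - D)) (D / 2)]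
    refine lintegral_congr fun c => ?_
    congr 1
    ring
  simp_rw [h1]
  rw [lintegral_lintegral_swap, lintegral_congr h2, lintegral_lintegral_swap]
  · exact (hF.comp (by fun_prop : Measurable fun z : ℝ × ℝ =>
      (z.2 + z.1 / 2, z.2 - z.1 / 2))).aemeasurable
  · exact (hF.comp (by fun_prop : Measurable fun z : ℝ × ℝ => (z.1, z.1 - z.2))).aemeasurable

/-- The difference of two independent samples of a `ν`-strongly log-concave density on `ℝ` is
sub-Gaussian with variance proxy `2 / ν`. -/
theorem lintegral_lintegral_cosh_sub_le {l : ℝ → ℝ} {ν : ℝ} (hν0 : 0 < ν)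
    (hl : Differentiable ℝ l)
    (hν : ∀ x x', (deriv l x - deriv l x') * (x - x') ≤ -ν * |x - x'| ^ 2)
    (μ : Measure ℝ) [IsProbabilityMeasure μ]
    (hμ : μ = volume.withDensity fun x => ENNReal.ofReal (Real.exp (l x))) (s : ℝ) :
    ∫⁻ x, ∫⁻ x', ENNReal.ofReal (Real.cosh (s * (x - x'))) ∂μ ∂μ
      ≤ ENNReal.ofReal (Real.exp (s ^ 2 / ν)) := by
  have hlm : Measurable l := hl.continuous.measurable
  have hρ : Measurable fun x => ENNReal.ofReal (Real.exp (l x)) := by fun_prop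
  have hcosh : Measurable Real.cosh := Real.continuous_cosh.measurable
  have swap : ∀ G : ℝ → ℝ → ℝ≥0∞, Measurable (Function.uncurry G) →
      ∫⁻ x, ∫⁻ x', G x x' ∂μ ∂μ = ∫⁻ c, ∫⁻ D, G (c + D / 2) (c - D / 2)
        * ENNReal.ofReal (Real.exp (l (c + D / 2) + l (c - D / 2))) := by
    intro G hG
    rw [← lintegral_lintegral_midpoint
      (F := fun x x' => G x x' * ENNReal.ofReal (Real.exp (l x + l x')))]
    · have hG' : Measurable fun x => ∫⁻ x', G x x' ∂μ := hG.lintegral_prod_right'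
      rw [hμ] at hG' ⊢
      rw [lintegral_withDensity_eq_lintegral_mul _ hρ hG']
      refine lintegral_congr fun x => ?_
      have hGx : Measurable (G x) := hG.comp measurable_prodMk_left
      rw [Pi.mul_apply, lintegral_withDensity_eq_lintegral_mul _ hρ hGx,
        ← lintegral_const_mul _ (hρ.mul hGx)]
      refine lintegral_congr fun x' => ?_
      rw [Pi.mul_apply, Real.exp_add, ENNReal.ofReal_mul (Real.exp_pos _).le]
      ring
    · refine Measurable.mul hG ?_
      fun_prop
  have h1 := swap (fun x x' => ENNReal.ofReal (Real.cosh (s * (x - x')))) (by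
    refine Measurable.ennreal_ofReal (hcosh.comp ?_)
    fun_prop)
  -- Taking `G = 1` shows that the weight in `(c, D)` has total mass one.
  have h2 := swap (fun _ _ => 1) measurable_const
  simp only [lintegral_const, measure_univ, one_mul] at h2
  rw [h1]
  have hsub : ∀ c D : ℝ, c + D / 2 - (c - D / 2) = D := fun c D => by ring
  simp_rw [hsub]
  -- The variance for which `D² / (2 v) = ν D² / 4`.
  set v : ℝ≥0 := ⟨2 / ν, by positivity⟩ with hv
  have hvν : (v : ℝ) = 2 / ν := rfl
  have hv0 : v ≠ 0 := by
    intro h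
    have : (v : ℝ) = 0 := by rw [h]; rfl
    rw [hvν] at this
    exact (div_pos two_pos hν0).ne' this
  calc _ ≤ ∫⁻ c, ENNReal.ofReal (Real.exp (v * s ^ 2 / 2)) *
        ∫⁻ D, ENNReal.ofReal (Real.exp (l (c + D / 2) + l (c - D / 2))) := by
        refine lintegral_mono fun c =>
          lintegral_cosh_mul_exp_le hv0 (by fun_prop) (fun y z hyz => ?_) s
        have := midpoint_add_sq_antitone hl hν c hyz
        have e : ∀ t : ℝ, t ^ 2 / (2 * (v : ℝ)) = ν * t ^ 2 / 4 := by
          intro t; rw [hvν]; field_simp; ring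
        rw [e, e]
        exact this
    _ = ENNReal.ofReal (Real.exp (s ^ 2 / ν)) := by
        rw [lintegral_const_mul, ← h2, mul_one]
        · rw [hvν]
          congr 2
          field_simp
        · refine Measurable.lintegral_prod_right' (f := fun z : ℝ × ℝ =>
            ENNReal.ofReal (Real.exp (l (z.1 + z.2 / 2) + l (z.1 - z.2 / 2)))) ?_
          fun_prop

/-! ### Exponential moments of centred Lipschitz functions -/

theorem one_add_sq_div_two_le_cosh (x : ℝ) : 1 + x ^ 2 / 2 ≤ Real.cosh x := by
  have h1 : Real.cosh x = 1 + 2 * Real.sinh (x / 2) ^ 2 := by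
    have h := Real.cosh_two_mul (x / 2)
    have h' := Real.cosh_sq (x / 2)
    rw [mul_div_cancel₀ x (two_ne_zero)] at h
    linarith
  have h2 : (x / 2) ^ 2 ≤ Real.sinh (x / 2) ^ 2 := by
    rw [← sq_abs (x / 2), ← sq_abs (Real.sinh (x / 2)), Real.abs_sinh]
    have := Real.self_le_sinh_iff.2 (abs_nonneg (x / 2))
    gcongr
  rw [h1]
  nlinarith

theorem ofReal_integral_le_lintegral_ofReal {α : Type*} [MeasurableSpace α] {μ : Measure α}
    {f : α → ℝ} (hf : Integrable f μ) :
    ENNReal.ofReal (∫ x, f x ∂μ) ≤ ∫⁻ x, ENNReal.ofReal (f x) ∂μ := by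
  calc ENNReal.ofReal (∫ x, f x ∂μ) ≤ ENNReal.ofReal (∫ x, max (f x) 0 ∂μ) :=
        ENNReal.ofReal_le_ofReal (integral_mono hf hf.pos_part fun x => le_max_left _ _)
    _ = ∫⁻ x, ENNReal.ofReal (max (f x) 0) ∂μ :=
        ofReal_integral_eq_lintegral_ofReal hf.pos_part
          (Eventually.of_forall fun x => le_max_right _ _)
    _ = _ := by simp

/-- A Lipschitz function of a random variable whose symmetrization is sub-Gaussian is
integrable. -/
theorem integrable_of_cosh_sub_le {μ : Measure ℝ} [IsProbabilityMeasure μ] {ν : ℝ}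
    (hμ : ∀ s : ℝ, ∫⁻ x, ∫⁻ x', ENNReal.ofReal (Real.cosh (s * (x - x'))) ∂μ ∂μ
      ≤ ENNReal.ofReal (Real.exp (s ^ 2 / ν)))
    {f : ℝ → ℝ} {L : ℝ} (hfm : Measurable f) (hf : ∀ x x', |f x - f x'| ≤ L * |x - x'|) :
    Integrable f μ := by
  have hL : 0 ≤ L := by
    have := (abs_nonneg _).trans (hf 1 0)
    simpa using this
  have hm : Measurable (Function.uncurry fun x x' : ℝ =>
      ENNReal.ofReal (Real.cosh (1 * (x - x')))) := by
    refine (Real.continuous_cosh.measurable.comp ?_).ennreal_ofReal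
    fun_prop
  -- Finiteness of the double integral provides one point `x₀` at which `cosh (x₀ - ·)` is
  -- integrable; it dominates `|x - x₀|`, hence `f` up to constants.
  have hfin := ae_lt_top hm.lintegral_prod_right' ((hμ 1).trans_lt ENNReal.ofReal_lt_top).ne
  obtain ⟨x₀, hx₀⟩ := hfin.exists
  have hci : Integrable (fun x' => Real.cosh (1 * (x₀ - x'))) μ := by
    refine ⟨(Real.continuous_cosh.comp (by fun_prop)).aestronglyMeasurable, ?_⟩
    rw [hasFiniteIntegral_iff_ofReal (Eventually.of_forall fun x => (Real.cosh_pos _).le)]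
    exact hx₀
  refine ((integrable_const |f x₀|).add (hci.const_mul L)).mono' hfm.aestronglyMeasurable
    (Eventually.of_forall fun x => ?_)
  have h1 := hf x x₀
  have h2 : |x - x₀| ≤ Real.cosh (1 * (x₀ - x)) := by
    have := one_add_sq_div_two_le_cosh (1 * (x₀ - x))
    rw [abs_sub_comm]
    nlinarith [sq_nonneg (|x₀ - x| - 1), sq_abs (x₀ - x)]
  have h3 : |f x| ≤ |f x₀| + |f x - f x₀| := by
    have := abs_add_le (f x₀) (f x - f x₀)
    rwa [add_sub_cancel] at this
  have h4 := mul_le_mul_of_nonneg_left h2 hL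
  simp only [Pi.add_apply, Real.norm_eq_abs]
  linarith

/-- The two variables are exchangeable, so a bound on the symmetrization of `A` suffices. This turns
an exponential of a difference into a `cosh`. -/
theorem lintegral_lintegral_le_of_add_swap_le {α : Type*} [MeasurableSpace α] {μ : Measure α}
    [SFinite μ] {A B : α → α → ℝ≥0∞} (hA : Measurable (Function.uncurry A))
    (hB : Measurable (Function.uncurry B)) (h : ∀ x y, A x y + A y x ≤ 2 * B x y) :
    ∫⁻ x, ∫⁻ y, A x y ∂μ ∂μ ≤ ∫⁻ x, ∫⁻ y, B x y ∂μ ∂μ := by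
  have hA' : Measurable fun x => ∫⁻ y, A x y ∂μ := hA.lintegral_prod_right'
  have hB' : Measurable fun x => ∫⁻ y, B x y ∂μ := hB.lintegral_prod_right'
  have h2 : 2 * ∫⁻ x, ∫⁻ y, A x y ∂μ ∂μ ≤ 2 * ∫⁻ x, ∫⁻ y, B x y ∂μ ∂μ := by
    calc 2 * ∫⁻ x, ∫⁻ y, A x y ∂μ ∂μ
        = (∫⁻ x, ∫⁻ y, A x y ∂μ ∂μ) + ∫⁻ x, ∫⁻ y, A y x ∂μ ∂μ := by
          rw [two_mul, lintegral_lintegral_swap (f := fun x y => A y x)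
            (hA.comp measurable_swap).aemeasurable]
      _ = ∫⁻ x, ∫⁻ y, (A x y + A y x) ∂μ ∂μ := by
          rw [← lintegral_add_left hA']
          exact lintegral_congr fun x =>
            (lintegral_add_left (hA.comp measurable_prodMk_left) _).symm
      _ ≤ ∫⁻ x, ∫⁻ y, 2 * B x y ∂μ ∂μ :=
          lintegral_mono fun x => lintegral_mono fun y => h x y
      _ = _ := by
          rw [← lintegral_const_mul _ hB']
          exact lintegral_congr fun x => lintegral_const_mul _ (hB.comp measurable_prodMk_left)
  exact (ENNReal.mul_le_mul_iff_right (by norm_num) (by norm_num)).1 h2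

/-- A centred Lipschitz function of a random variable whose symmetrization is sub-Gaussian is
sub-Gaussian. -/
theorem lintegral_exp_le_of_cosh_sub_le {μ : Measure ℝ} [IsProbabilityMeasure μ] {ν : ℝ}
    (hμ : ∀ s : ℝ, ∫⁻ x, ∫⁻ x', ENNReal.ofReal (Real.cosh (s * (x - x'))) ∂μ ∂μ
      ≤ ENNReal.ofReal (Real.exp (s ^ 2 / ν)))
    {f : ℝ → ℝ} {L : ℝ} (hfm : Measurable f) (hf : ∀ x x', |f x - f x'| ≤ L * |x - x'|)
    (h0 : ∫ x, f x ∂μ = 0) (t : ℝ) :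
    ∫⁻ x, ENNReal.ofReal (Real.exp (t * f x)) ∂μ
      ≤ ENNReal.ofReal (Real.exp (t ^ 2 * L ^ 2 / ν)) := by
  have hfi := integrable_of_cosh_sub_le hμ hfm hf
  have hL : 0 ≤ L := by
    have := (abs_nonneg _).trans (hf 1 0)
    simpa using this
  -- Jensen's inequality for the centred `f`, from `1 - u ≤ exp (-u)`. It permits multiplying by the
  -- factor of an independent copy, which is the symmetrization.
  have hone : 1 ≤ ∫⁻ x, ENNReal.ofReal (Real.exp (-(t * f x))) ∂μ := by
    calc (1 : ℝ≥0∞) = ENNReal.ofReal (∫ x, (1 - t * f x) ∂μ) := by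
          rw [integral_sub (integrable_const _) (hfi.const_mul t), integral_const_mul, h0]
          simp
      _ ≤ ∫⁻ x, ENNReal.ofReal (1 - t * f x) ∂μ :=
          ofReal_integral_le_lintegral_ofReal ((integrable_const _).sub (hfi.const_mul t))
      _ ≤ _ := lintegral_mono fun x => ENNReal.ofReal_le_ofReal (by
          linarith [Real.add_one_le_exp (-(t * f x))])
  have hem : ∀ u : ℝ, Measurable fun x => ENNReal.ofReal (Real.exp (u * f x)) := by
    intro u; fun_prop
  set A : ℝ → ℝ → ℝ≥0∞ := fun x x' => ENNReal.ofReal (Real.exp (t * (f x - f x'))) with hA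
  have hAm : Measurable (Function.uncurry A) := by
    have : Measurable fun z : ℝ × ℝ => ENNReal.ofReal (Real.exp (t * (f z.1 - f z.2))) := by
      fun_prop
    exact this
  have hprod : ∫⁻ x, ∫⁻ x', A x x' ∂μ ∂μ = (∫⁻ x, ENNReal.ofReal (Real.exp (t * f x)) ∂μ)
      * ∫⁻ x, ENNReal.ofReal (Real.exp (-(t * f x))) ∂μ := by
    rw [← lintegral_mul_const _ (hem t)]
    refine lintegral_congr fun x => ?_
    have hem' := hem (-t)
    simp only [neg_mul] at hem'
    rw [← lintegral_const_mul _ hem']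
    refine lintegral_congr fun x' => ?_
    rw [← ENNReal.ofReal_mul (Real.exp_pos _).le, ← Real.exp_add]
    simp only [hA]
    ring_nf
  have hsymm : ∫⁻ x, ∫⁻ x', A x x' ∂μ ∂μ
      ≤ ∫⁻ x, ∫⁻ x', ENNReal.ofReal (Real.cosh (t * L * (x - x'))) ∂μ ∂μ := by
    refine lintegral_lintegral_le_of_add_swap_le hAm ?_ fun x x' => ?_
    · refine (Real.continuous_cosh.measurable.comp ?_).ennreal_ofReal
      fun_prop
    · simp only [hA]
      rw [← ENNReal.ofReal_add (Real.exp_pos _).le (Real.exp_pos _).le,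
        ← ENNReal.ofReal_ofNat 2, ← ENNReal.ofReal_mul zero_le_two]
      refine ENNReal.ofReal_le_ofReal ?_
      have h1 : Real.cosh (t * (f x - f x')) ≤ Real.cosh (t * L * (x - x')) := by
        rw [Real.cosh_le_cosh, abs_mul, abs_mul, abs_mul, abs_of_nonneg hL, mul_assoc]
        exact mul_le_mul_of_nonneg_left (hf x x') (abs_nonneg t)
      rw [Real.cosh_eq] at h1
      rw [show t * (f x' - f x) = -(t * (f x - f x')) by ring]
      linarith
  calc ∫⁻ x, ENNReal.ofReal (Real.exp (t * f x)) ∂μ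
      ≤ (∫⁻ x, ENNReal.ofReal (Real.exp (t * f x)) ∂μ)
        * ∫⁻ x, ENNReal.ofReal (Real.exp (-(t * f x))) ∂μ := le_mul_of_one_le_right' hone
    _ ≤ ∫⁻ x, ∫⁻ x', ENNReal.ofReal (Real.cosh (t * L * (x - x'))) ∂μ ∂μ := by
        rw [← hprod]
        exact hsymm
    _ ≤ _ := by
        refine (hμ (t * L)).trans (le_of_eq ?_)
        rw [mul_pow]

theorem exp_sum_integrable_and_le {μ : Measure ℝ} [IsProbabilityMeasure μ] {f : ℝ → ℝ} {c : ℝ}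
    (hfm : Measurable f) {t : ℝ}
    (h : ∫⁻ x, ENNReal.ofReal (Real.exp (t * f x)) ∂μ ≤ ENNReal.ofReal (Real.exp c)) (T : ℕ) :
    Integrable (fun X : Fin T → ℝ => Real.exp (t * ∑ i, f (X i))) (Measure.pi fun _ => μ) ∧
      ∫ X : Fin T → ℝ, Real.exp (t * ∑ i, f (X i)) ∂(Measure.pi fun _ => μ)
        ≤ Real.exp (T * c) := by
  have hi : Integrable (fun x => Real.exp (t * f x)) μ := by
    refine ⟨by fun_prop, ?_⟩
    rw [hasFiniteIntegral_iff_ofReal (Eventually.of_forall fun x => (Real.exp_pos _).le)]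
    exact h.trans_lt ENNReal.ofReal_lt_top
  have hle : ∫ x, Real.exp (t * f x) ∂μ ≤ Real.exp c := by
    rw [← ENNReal.ofReal_le_ofReal_iff (Real.exp_pos _).le]
    rwa [ofReal_integral_eq_lintegral_ofReal hi
      (Eventually.of_forall fun x => (Real.exp_pos _).le)]
  simp_rw [Finset.mul_sum, Real.exp_sum]
  refine ⟨Integrable.fintype_prod (f := fun _ x => Real.exp (t * f x)) fun _ => hi, ?_⟩
  rw [integral_fintype_prod_eq_pow (fun x => Real.exp (t * f x)), Fintype.card_fin,
    Real.exp_nat_mul]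
  exact pow_le_pow_left₀ (integral_nonneg fun x => (Real.exp_pos _).le) hle T

/-! ### From exponential moments to power moments -/

section Moments

variable {Ω : Type*} [MeasurableSpace Ω] {P : Measure Ω} {S : Ω → ℝ}
  {τ : ℝ}

/-- The inequality `u ≤ exp (u - 1)` at `u = t |x| / q`, raised to the power `q`, dominates `|x| ^
q` by exponentials; `t² = q / (2 τ)` optimizes the resulting bound. -/
theorem lintegral_rpow_abs_le_of_mgf_le (hτ : 0 < τ)
    (hS : ∀ t : ℝ, Integrable (fun ω => Real.exp (t * S ω)) P ∧
      ∫ ω, Real.exp (t * S ω) ∂P ≤ Real.exp (t ^ 2 * τ)) {q : ℝ} (hq : 2 ≤ q) :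
    ∫⁻ ω, ENNReal.ofReal (|S ω| ^ q) ∂P ≤ ENNReal.ofReal ((2 * τ * q) ^ (q / 2)) := by
  have hq0 : 0 < q := by linarith
  set t : ℝ := √(q / (2 * τ)) with ht
  have ht0 : 0 < t := Real.sqrt_pos.2 (by positivity)
  have ht2 : t ^ 2 = q / (2 * τ) := Real.sq_sqrt (by positivity)
  set C : ℝ := (2 * τ * q) ^ (q / 2) * Real.exp (-q) with hC
  have hC0 : 0 ≤ C := by positivity
  have hCq : (q / t) ^ q = (2 * τ * q) ^ (q / 2) := by
    have : q / t = √(2 * τ * q) := by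
      symm
      rw [Real.sqrt_eq_iff_mul_self_eq_of_pos (by positivity), ← sq, div_pow, ht2]
      field_simp
    rw [this, Real.sqrt_eq_rpow, ← Real.rpow_mul (by positivity)]
    congr 1
    ring
  have hpt : ∀ x : ℝ, |x| ^ q ≤ C * (Real.exp (t * x) + Real.exp (-t * x)) := by
    intro x
    have h1 : t * |x| / q ≤ Real.exp (t * |x| / q - 1) := by
      linarith [Real.add_one_le_exp (t * |x| / q - 1)]
    have h2 := Real.rpow_le_rpow (by positivity) h1 hq0.le
    rw [← Real.exp_mul, show (t * |x| / q - 1) * q = t * |x| + -q by field_simp; ring,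
      Real.exp_add] at h2
    have h3 : Real.exp (t * |x|) ≤ Real.exp (t * x) + Real.exp (-t * x) := by
      rcases abs_choice x with h | h <;> rw [h]
      · linarith [Real.exp_pos (-t * x)]
      · rw [mul_neg, ← neg_mul]; linarith [Real.exp_pos (t * x)]
    calc |x| ^ q = (q / t) ^ q * (t * |x| / q) ^ q := by
          rw [← Real.mul_rpow (by positivity) (by positivity)]
          congr 1
          field_simp
      _ ≤ (q / t) ^ q * (Real.exp (t * |x|) * Real.exp (-q)) := by gcongr
      _ = C * Real.exp (t * |x|) := by rw [hCq, hC]; ring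
      _ ≤ _ := by gcongr
  have hi : Integrable (fun ω => C * (Real.exp (t * S ω) + Real.exp (-t * S ω))) P :=
    ((hS t).1.add (hS (-t)).1).const_mul C
  calc ∫⁻ ω, ENNReal.ofReal (|S ω| ^ q) ∂P
      ≤ ∫⁻ ω, ENNReal.ofReal (C * (Real.exp (t * S ω) + Real.exp (-t * S ω))) ∂P :=
        lintegral_mono fun ω => ENNReal.ofReal_le_ofReal (hpt _)
    _ = ENNReal.ofReal (∫ ω, C * (Real.exp (t * S ω) + Real.exp (-t * S ω)) ∂P) :=
        (ofReal_integral_eq_lintegral_ofReal hi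
          (Eventually.of_forall fun ω => by positivity)).symm
    _ ≤ _ := by
        refine ENNReal.ofReal_le_ofReal ?_
        rw [integral_const_mul, integral_add (hS t).1 (hS (-t)).1]
        have h1 := (hS t).2
        have h2 := (hS (-t)).2
        have e : t ^ 2 * τ = q / 2 := by rw [ht2]; field_simp
        rw [neg_sq] at h2
        rw [e] at h1 h2
        -- Only here is `2 ≤ q` essential: it absorbs the factor `2` from the two exponentials.
        have h3 : 2 ≤ Real.exp (q / 2) := by
          linarith [Real.add_one_le_exp (q / 2)]
        have h4 : Real.exp (-q) * (Real.exp (q / 2) + Real.exp (q / 2)) ≤ 1 := by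
          have : Real.exp (-q) * (Real.exp (q / 2) * Real.exp (q / 2)) = 1 := by
            rw [← Real.exp_add, ← Real.exp_add]; ring_nf; exact Real.exp_zero
          rw [← this]
          gcongr
          nlinarith
        calc _ ≤ C * (Real.exp (q / 2) + Real.exp (q / 2)) := by gcongr
          _ = (2 * τ * q) ^ (q / 2) * (Real.exp (-q) *
              (Real.exp (q / 2) + Real.exp (q / 2))) := by rw [hC]; ring
          _ ≤ (2 * τ * q) ^ (q / 2) * 1 := by gcongr
          _ = _ := mul_one _

/-- Since `t² x² ≤ 2 (cosh (t x) - 1)`, dividing by `t²` and letting `t → 0` gives `2 τ`, half the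
general bound at `q = 2`. This keeps the factor `q`, not `2`, when `1 ≤ q < 2`. -/
theorem lintegral_sq_le_of_mgf_le [IsProbabilityMeasure P] (hSm : Measurable S)
    (hS : ∀ t : ℝ, Integrable (fun ω => Real.exp (t * S ω)) P ∧
      ∫ ω, Real.exp (t * S ω) ∂P ≤ Real.exp (t ^ 2 * τ)) :
    ∫⁻ ω, ENNReal.ofReal (S ω ^ 2) ∂P ≤ ENNReal.ofReal (2 * τ) := by
  have hpt : ∀ t x : ℝ,
      t ^ 2 * x ^ 2 ≤ Real.exp (t * x) + Real.exp (-t * x) - 2 := by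
    intro t x
    have := one_add_sq_div_two_le_cosh (t * x)
    rw [Real.cosh_eq, ← neg_mul] at this
    linarith [mul_pow t x 2]
  have hint : ∀ t : ℝ, Integrable
      (fun ω => Real.exp (t * S ω) + Real.exp (-t * S ω) - 2) P := fun t =>
    ((hS t).1.add (hS (-t)).1).sub (integrable_const _)
  have hi : Integrable (fun ω => S ω ^ 2) P := by
    refine (hint 1).mono' (hSm.pow_const 2).aestronglyMeasurable
      (Eventually.of_forall fun ω => ?_)
    rw [Real.norm_of_nonneg (sq_nonneg _)]
    simpa using hpt 1 (S ω)
  rw [← ofReal_integral_eq_lintegral_ofReal hi (Eventually.of_forall fun ω => sq_nonneg _)]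
  refine ENNReal.ofReal_le_ofReal ?_
  have key : ∀ t : ℝ, 0 < t → t ^ 2 * τ < 1 →
      (1 - t ^ 2 * τ) * ∫ ω, S ω ^ 2 ∂P ≤ 2 * τ := by
    intro t ht0 ht
    have h1 : t ^ 2 * ∫ ω, S ω ^ 2 ∂P ≤ 2 * (Real.exp (t ^ 2 * τ) - 1) := by
      rw [← integral_const_mul]
      refine (integral_mono (hi.const_mul _) (hint t) fun ω => hpt t (S ω)).trans ?_
      have hadd : Integrable (fun ω => Real.exp (t * S ω) + Real.exp (-t * S ω)) P :=
        (hS t).1.add (hS (-t)).1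
      rw [integral_sub hadd (integrable_const _), integral_add (hS t).1 (hS (-t)).1]
      have h1 := (hS t).2
      have h2 := (hS (-t)).2
      rw [neg_sq] at h2
      simp only [integral_const, probReal_univ, smul_eq_mul, one_mul]
      linarith
    have h2 : (1 - t ^ 2 * τ) * (Real.exp (t ^ 2 * τ) - 1) ≤ t ^ 2 * τ := by
      have h3 := Real.add_one_le_exp (-(t ^ 2 * τ))
      have h4 : Real.exp (-(t ^ 2 * τ)) * Real.exp (t ^ 2 * τ) = 1 := by
        rw [← Real.exp_add]; simp
      have := mul_le_mul_of_nonneg_right h3 (Real.exp_pos (t ^ 2 * τ)).le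
      linarith
    have h5 : t ^ 2 * ((1 - t ^ 2 * τ) * ∫ ω, S ω ^ 2 ∂P) ≤ t ^ 2 * (2 * τ) := by
      nlinarith [mul_le_mul_of_nonneg_left h1 (sub_pos.2 ht).le]
    exact le_of_mul_le_mul_left h5 (by positivity)
  have hlim : Tendsto (fun t : ℝ => (1 - t ^ 2 * τ) * ∫ ω, S ω ^ 2 ∂P) (𝓝[>] 0)
      (𝓝 ((1 - (0 : ℝ) ^ 2 * τ) * ∫ ω, S ω ^ 2 ∂P)) :=
    (Continuous.tendsto (by fun_prop) 0).mono_left nhdsWithin_le_nhds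
  have hev : ∀ᶠ t : ℝ in 𝓝[>] 0, t ^ 2 * τ < 1 := by
    have : Tendsto (fun t : ℝ => t ^ 2 * τ) (𝓝[>] 0) (𝓝 ((0 : ℝ) ^ 2 * τ)) :=
      (Continuous.tendsto (by fun_prop) 0).mono_left nhdsWithin_le_nhds
    exact this.eventually (gt_mem_nhds (by simp))
  have := le_of_tendsto hlim (by
    filter_upwards [hev, self_mem_nhdsWithin] with t ht ht0
    exact key t ht0 ht)
  simpa using this

end Moments

/-! ### Moment recursion by dilation -/

section Scaling

variable {E : Type*} [NormedAddCommGroup E] [InnerProductSpace ℝ E] [MeasurableSpace E]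
  [BorelSpace E] [FiniteDimensional ℝ E]

theorem integrable_exp_neg_mul_sq_norm {b : ℝ} (hb : 0 < b) :
    Integrable (fun v : E => Real.exp (-b * ‖v‖ ^ 2)) := by
  have h := (GaussianFourier.integrable_cexp_neg_mul_sq_norm_add (V := E) (b := (b : ℂ))
    (by simpa using hb) 0 0).norm
  refine h.congr (Eventually.of_forall fun v => ?_)
  simp only [Complex.norm_exp]
  congr 1
  simp [← Complex.ofReal_pow]

/-- `‖y‖ ^ k ≤ exp (k ‖y‖)`, and half of the quadratic term absorbs all linear ones by completing
the square, leaving a Gaussian. -/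
theorem integrable_rpow_norm_mul_exp {W : E → ℝ} (hW : Continuous W) {β M C : ℝ} (hM : 0 < M)
    (h : ∀ y, W y ≤ C + β * ‖y‖ - M * ‖y‖ ^ 2) {k : ℝ} (hk : 0 ≤ k) :
    Integrable (fun y => ‖y‖ ^ k * Real.exp (W y)) := by
  refine ((integrable_exp_neg_mul_sq_norm (E := E) (half_pos hM)).const_mul
    (Real.exp (C + (k + β) ^ 2 / (2 * M)))).mono' ?_ (Eventually.of_forall fun y => ?_)
  · exact ((continuous_norm.rpow_const fun _ => Or.inr hk).mul
      (Real.continuous_exp.comp hW)).aestronglyMeasurable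
  · have h1 : ‖y‖ ^ k ≤ Real.exp (k * ‖y‖) := by
      rw [mul_comm, Real.exp_mul]
      exact Real.rpow_le_rpow (norm_nonneg _) (by linarith [Real.add_one_le_exp ‖y‖]) hk
    rw [Real.norm_of_nonneg (by positivity)]
    calc ‖y‖ ^ k * Real.exp (W y)
        ≤ Real.exp (k * ‖y‖) * Real.exp (C + β * ‖y‖ - M * ‖y‖ ^ 2) := by
          gcongr
          exact h y
      _ = Real.exp (k * ‖y‖ + (C + β * ‖y‖ - M * ‖y‖ ^ 2)) := (Real.exp_add _ _).symm
      _ ≤ Real.exp (C + (k + β) ^ 2 / (2 * M) + -(M / 2) * ‖y‖ ^ 2) := by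
          refine Real.exp_le_exp.2 ?_
          have : (k + β) * ‖y‖ ≤ (k + β) ^ 2 / (2 * M) + M / 2 * ‖y‖ ^ 2 := by
            rw [← sub_nonneg]
            have : (k + β) ^ 2 / (2 * M) + M / 2 * ‖y‖ ^ 2 - (k + β) * ‖y‖
                = (k + β - M * ‖y‖) ^ 2 / (2 * M) := by
              field_simp
              ring
            rw [this]
            positivity
          linarith
      _ = _ := Real.exp_add _ _

/-- Moment recursion for a strongly log-concave weight, obtained by dilating the variable. -/
theorem moment_recursion {W : E → ℝ} {β M : ℝ}
    (hint : ∀ k : ℝ, 0 ≤ k → Integrable (fun y => ‖y‖ ^ k * Real.exp (W y)))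
    (h : ∀ r : ℝ, 0 < r → r < 1 → ∀ y,
      W y - W (r • y) ≤ (1 - r) * (β * ‖y‖ - M * r * ‖y‖ ^ 2))
    {q : ℝ} (hq : 2 ≤ q) :
    M * ∫ y, ‖y‖ ^ q * Real.exp (W y)
      ≤ (Module.finrank ℝ E + q - 2) * (∫ y, ‖y‖ ^ (q - 2) * Real.exp (W y))
        + β * ∫ y, ‖y‖ ^ (q - 1) * Real.exp (W y) := by
  set I : ℝ → ℝ := fun k => ∫ y, ‖y‖ ^ k * Real.exp (W y) with hI
  set n : ℕ := Module.finrank ℝ E with hn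
  set s : ℝ := n + q - 2 with hs
  have hs0 : 0 ≤ s := by rw [hs]; have := n.cast_nonneg (α := ℝ); linarith
  have hI0 : 0 ≤ I (q - 2) := integral_nonneg fun y => by positivity
  -- The substitution `y ↦ r • y` contributes `r ^ s`, and `exp (W (r • y)) ≥ exp (W y) (1 + W (r •
  -- y) - W y)` is bounded below by `h`. The limit `r → 1` plays the part of an integration by
  -- parts, with no derivative of `W`.
  have step : ∀ r : ℝ, 0 < r → r < 1 →
      r ^ s * (I (q - 2) + (1 - r) * (M * r * I q - β * I (q - 1))) ≤ I (q - 2) := by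
    intro r hr0 hr1
    have hsc : I (q - 2) = r ^ s * ∫ y, ‖y‖ ^ (q - 2) * Real.exp (W (r • y)) := by
      have h1 := Measure.integral_comp_smul_of_nonneg (volume : Measure E)
        (fun y => ‖y‖ ^ (q - 2) * Real.exp (W y)) r (hR := hr0.le)
      simp only [norm_smul, Real.norm_of_nonneg hr0.le,
        Real.mul_rpow hr0.le (norm_nonneg _), mul_assoc, integral_const_mul, smul_eq_mul] at h1
      have : r ^ s = r ^ n * r ^ (q - 2) := by
        rw [← Real.rpow_natCast, ← Real.rpow_add hr0]
        congr 1
        rw [hs]; ring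
      rw [this, mul_assoc, h1, ← mul_assoc, mul_inv_cancel₀ (by positivity), one_mul]
    have hi1 : Integrable fun y => ‖y‖ ^ (q - 2) * Real.exp (W (r • y)) := by
      have := (hint (q - 2) (by linarith)).comp_smul hr0.ne'
      simp only [norm_smul, Real.norm_of_nonneg hr0.le,
        Real.mul_rpow hr0.le (norm_nonneg _), mul_assoc] at this
      have h2 := this.const_mul (r ^ (q - 2))⁻¹
      refine h2.congr (Eventually.of_forall fun y => ?_)
      simp only
      rw [← mul_assoc, inv_mul_cancel₀ (by positivity), one_mul]
    have hi := ((hint (q - 2) (by linarith)).add ((((hint q (by linarith)).const_mul (M * r)).sub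
      ((hint (q - 1) (by linarith)).const_mul β)).const_mul (1 - r)))
    have hlow : I (q - 2) + (1 - r) * (M * r * I q - β * I (q - 1))
        ≤ ∫ y, ‖y‖ ^ (q - 2) * Real.exp (W (r • y)) := by
      have e : I (q - 2) + (1 - r) * (M * r * I q - β * I (q - 1))
          = ∫ y, (‖y‖ ^ (q - 2) * Real.exp (W y) + (1 - r) * (M * r * (‖y‖ ^ q * Real.exp (W y))
            - β * (‖y‖ ^ (q - 1) * Real.exp (W y)))) := by
        rw [integral_add, integral_const_mul, integral_sub, integral_const_mul,
          integral_const_mul]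
        · exact (hint q (by linarith)).const_mul _
        · exact (hint _ (by linarith)).const_mul _
        · exact hint _ (by linarith)
        · exact (((hint q (by linarith)).const_mul (M * r)).sub
            ((hint (q - 1) (by linarith)).const_mul β)).const_mul (1 - r)
      rw [e]
      refine integral_mono hi hi1 fun y => ?_
      simp only
      have hy0 := norm_nonneg y
      have hpow : ‖y‖ ^ (q - 2) * (1 + (1 - r) * (M * r * ‖y‖ ^ 2 - β * ‖y‖))
          = ‖y‖ ^ (q - 2) + (1 - r) * (M * r * ‖y‖ ^ q - β * ‖y‖ ^ (q - 1)) := by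
        rcases hy0.eq_or_lt with h0 | h0
        · rw [← h0, Real.zero_rpow (by linarith : q ≠ 0), Real.zero_rpow (by linarith : q - 1 ≠ 0)]
          simp
        · have e1 : ‖y‖ ^ q = ‖y‖ ^ (q - 2) * ‖y‖ ^ 2 := by
            rw [← Real.rpow_natCast, ← Real.rpow_add h0]; congr 1; push_cast; ring
          have e2 : ‖y‖ ^ (q - 1) = ‖y‖ ^ (q - 2) * ‖y‖ := by
            conv_rhs => rw [← Real.rpow_one ‖y‖, ← Real.rpow_mul hy0, one_mul, ← Real.rpow_add h0]
            congr 1; ring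
          rw [e1, e2]; ring
      have hexp : Real.exp (W y) * (1 + (1 - r) * (M * r * ‖y‖ ^ 2 - β * ‖y‖))
          ≤ Real.exp (W (r • y)) := by
        have hh := h r hr0 hr1 y
        calc Real.exp (W y) * (1 + (1 - r) * (M * r * ‖y‖ ^ 2 - β * ‖y‖))
            ≤ Real.exp (W y) * Real.exp (W (r • y) - W y) := by
              gcongr
              have := Real.add_one_le_exp (W (r • y) - W y)
              nlinarith
          _ = _ := by rw [← Real.exp_add]; congr 1; ring
      calc _ = Real.exp (W y) * (‖y‖ ^ (q - 2) +
            (1 - r) * (M * r * ‖y‖ ^ q - β * ‖y‖ ^ (q - 1))) := by ring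
        _ = ‖y‖ ^ (q - 2) * (Real.exp (W y) *
            (1 + (1 - r) * (M * r * ‖y‖ ^ 2 - β * ‖y‖))) := by rw [← hpow]; ring
        _ ≤ _ := by gcongr
    calc _ ≤ r ^ s * ∫ y, ‖y‖ ^ (q - 2) * Real.exp (W (r • y)) := by gcongr
      _ = I (q - 2) := hsc.symm
  have bound : ∀ r : ℝ, 0 < r → r < 1 →
      r ^ s * (r * (M * r * I q - β * I (q - 1))) ≤ s * I (q - 2) := by
    intro r hr0 hr1
    rcases le_or_gt (M * r * I q - β * I (q - 1)) 0 with hB | hB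
    · have : r ^ s * (r * (M * r * I q - β * I (q - 1))) ≤ 0 :=
        mul_nonpos_of_nonneg_of_nonpos (by positivity)
          (mul_nonpos_of_nonneg_of_nonpos hr0.le hB)
      exact this.trans (by positivity)
    · set B := M * r * I q - β * I (q - 1) with hBdef
      -- Dividing by `u` instead of `1 - r` makes both comparisons elementary: `u r ≤ 1 - r` and `1
      -- - r ^ s ≤ u s`. The cost is a factor `r`, harmless as `r → 1`.
      set u : ℝ := -Real.log r with hu
      have hu0 : 0 < u := by rw [hu]; linarith [Real.log_neg hr0 hr1]
      have hru : r = Real.exp (-u) := by rw [hu, neg_neg, Real.exp_log hr0]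
      have h1 : u * r ≤ 1 - r := by
        have := Real.add_one_le_exp u
        have h2 : Real.exp u * r = 1 := by rw [hru, ← Real.exp_add]; simp
        nlinarith
      have h3 : 1 - r ^ s ≤ u * s := by
        have : r ^ s = Real.exp (-(u * s)) := by
          rw [hru, ← Real.exp_mul]; congr 1; ring
        rw [this]
        linarith [Real.add_one_le_exp (-(u * s))]
      have h4 := step r hr0 hr1
      have hrs : 0 < r ^ s := by positivity
      have h5 : u * (r ^ s * (r * B)) ≤ u * (s * I (q - 2)) := by
        calc u * (r ^ s * (r * B)) = r ^ s * (u * r * B) := by ring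
          _ ≤ r ^ s * ((1 - r) * B) := by gcongr
          _ ≤ (1 - r ^ s) * I (q - 2) := by linarith
          _ ≤ u * s * I (q - 2) := by gcongr
          _ = _ := by ring
      exact le_of_mul_le_mul_left h5 hu0
  have hlim : Tendsto (fun r : ℝ => r ^ s * (r * (M * r * I q - β * I (q - 1)))) (𝓝[<] 1)
      (𝓝 ((1 : ℝ) ^ s * (1 * (M * 1 * I q - β * I (q - 1))))) := by
    refine Tendsto.mono_left ?_ nhdsWithin_le_nhds
    refine ContinuousAt.tendsto (x := (1 : ℝ)) ?_
    exact (Real.continuousAt_rpow_const 1 s (Or.inl one_ne_zero)).mul (by fun_prop)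
  have := le_of_tendsto hlim (by
    filter_upwards [Ioo_mem_nhdsLT (zero_lt_one (α := ℝ))] with r hr
    exact bound r hr.1 hr.2)
  rw [Real.one_rpow] at this
  linarith

end Scaling

/-! ### Strong concavity and smoothness along rays -/

section Gradient

variable {E : Type*} [NormedAddCommGroup E] [InnerProductSpace ℝ E] [CompleteSpace E]
  {f : E → ℝ}

theorem hasDerivAt_comp_line (hf : Differentiable ℝ f) (z y : E) (t : ℝ) :
    HasDerivAt (fun t : ℝ => f (z + t • y)) (inner ℝ (gradient f (z + t • y)) y) t := by
  have h1 := (hf (z + t • y)).hasGradientAt.hasFDerivAt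
  have h2 : HasDerivAt (fun t : ℝ => z + t • y) y t := by
    simpa using ((hasDerivAt_id t).smul_const y).const_add z
  exact (h1.comp_hasDerivAt t h2).congr_deriv (by simp)

/-- Along a ray, a strongly concave function lies below the bound given by its gradient at the
origin of the ray. -/
theorem sub_le_of_strongly_concave (hf : Differentiable ℝ f) {m : ℝ} (hm : 0 ≤ m)
    (hmono : ∀ x y, inner ℝ (gradient f x - gradient f y) (x - y) ≤ -m * ‖x - y‖ ^ 2)
    (z y : E) {r : ℝ} (hr0 : 0 ≤ r) (hr1 : r < 1) :
    f (z + y) - f (z + r • y) ≤ (1 - r) * (inner ℝ (gradient f z) y - m * r * ‖y‖ ^ 2) := by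
  obtain ⟨t, ht, htd⟩ := exists_hasDerivAt_eq_slope (fun t : ℝ => f (z + t • y))
    (fun t => inner ℝ (gradient f (z + t • y)) y) hr1
    (fun t _ => (hasDerivAt_comp_line hf z y t).continuousAt.continuousWithinAt)
    (fun t _ => hasDerivAt_comp_line hf z y t)
  rw [one_smul, eq_div_iff (sub_pos.2 hr1).ne'] at htd
  have ht0 : 0 < t := hr0.trans_lt ht.1
  have h1 := hmono (z + t • y) z
  rw [add_sub_cancel_left, real_inner_smul_right, norm_smul, Real.norm_of_nonneg ht0.le,
    inner_sub_left] at h1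
  have h2 : inner ℝ (gradient f (z + t • y)) y - inner ℝ (gradient f z) y
      ≤ -m * t * ‖y‖ ^ 2 := by
    refine le_of_mul_le_mul_left (h1.trans (le_of_eq ?_)) ht0
    ring
  -- The mean value point `t` lies in `(r, 1)` and is otherwise unknown, so it is replaced by `r`.
  have h3 : m * r * ‖y‖ ^ 2 ≤ m * t * ‖y‖ ^ 2 := by
    have := ht.1.le
    gcongr
  rw [← htd, mul_comm]
  refine mul_le_mul_of_nonneg_left ?_ (sub_pos.2 hr1).le
  linarith

/-- Mean value theorem and Cauchy–Schwarz. The constant `L` instead of the sharp `L / 2` is enough,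
as only the order `t²` of the error matters for the score. -/
theorem le_sub_of_lipschitz_gradient (hf : Differentiable ℝ f) {L : ℝ} (hL : 0 ≤ L)
    (hlip : ∀ x y, ‖gradient f x - gradient f y‖ ≤ L * ‖x - y‖) (z y : E) {t : ℝ} (ht : 0 < t) :
    t * inner ℝ (gradient f z) y - t ^ 2 * (L * ‖y‖ ^ 2) ≤ f (z + t • y) - f z := by
  obtain ⟨s, hs, hsd⟩ := exists_hasDerivAt_eq_slope (fun t : ℝ => f (z + t • y))
    (fun t => inner ℝ (gradient f (z + t • y)) y) ht
    (fun t _ => (hasDerivAt_comp_line hf z y t).continuousAt.continuousWithinAt)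
    (fun t _ => hasDerivAt_comp_line hf z y t)
  rw [zero_smul, add_zero, sub_zero, eq_div_iff ht.ne'] at hsd
  have h1 := hlip (z + s • y) z
  rw [add_sub_cancel_left, norm_smul, Real.norm_of_nonneg hs.1.le] at h1
  have h2 := neg_le_of_abs_le (abs_real_inner_le_norm (gradient f (z + s • y) - gradient f z) y)
  rw [inner_sub_left] at h2
  have h3 : ‖gradient f (z + s • y) - gradient f z‖ * ‖y‖ ≤ t * (L * ‖y‖ ^ 2) := by
    calc _ ≤ L * (s * ‖y‖) * ‖y‖ := by gcongr
      _ ≤ L * (t * ‖y‖) * ‖y‖ := by gcongr; exact hs.2.le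
      _ = _ := by ring
  rw [← hsd]
  nlinarith

end Gradient

/-! ### Moments of a strongly log-concave measure -/

section TiltedMoments

variable {E : Type*} [NormedAddCommGroup E] [InnerProductSpace ℝ E] [MeasurableSpace E]
  [BorelSpace E] [FiniteDimensional ℝ E]

/-- Moments of a strongly log-concave probability measure around a point at which the gradient
of the log-density has norm at most `β`. -/
theorem lintegral_rpow_norm_tilted_le {W : E → ℝ} {β M : ℝ} (hM : 0 < M)
    (hint : ∀ k : ℝ, 0 ≤ k → Integrable (fun y => ‖y‖ ^ k * Real.exp (W y)))
    (h : ∀ r : ℝ, 0 < r → r < 1 → ∀ y,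
      W y - W (r • y) ≤ (1 - r) * (β * ‖y‖ - M * r * ‖y‖ ^ 2))
    (hβ : 0 ≤ β) {q : ℝ} (hq : 2 ≤ q) :
    ∫⁻ y, ENNReal.ofReal (‖y‖ ^ q) ∂((volume : Measure E).tilted W)
      ≤ ENNReal.ofReal
        ((2 * (Module.finrank ℝ E + q - 2) / M + β ^ 2 / M ^ 2) ^ (q / 2)) := by
  have hexp : Integrable (fun y => Real.exp (W y)) := by simpa using hint 0 le_rfl
  have := isProbabilityMeasure_tilted hexp
  set μ := (volume : Measure E).tilted W with hμ
  set Z : ℝ := ∫ y, Real.exp (W y) with hZ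
  have hZ0 : 0 < Z := integral_exp_pos hexp
  have hJ : ∀ k : ℝ, ∫ y, ‖y‖ ^ k ∂μ = (∫ y, ‖y‖ ^ k * Real.exp (W y)) / Z := by
    intro k
    rw [hμ, integral_tilted, ← integral_div]
    refine integral_congr_ae (Eventually.of_forall fun y => ?_)
    simp only [smul_eq_mul]
    ring
  have hJi : ∀ k : ℝ, 0 ≤ k → Integrable (fun y => ‖y‖ ^ k) μ := by
    intro k hk
    rw [hμ, integrable_tilted_iff hexp]
    simpa [mul_comm] using hint k hk
  set J : ℝ → ℝ := fun k => ∫ y, ‖y‖ ^ k ∂μ with hJdef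
  have hJ0 : ∀ k, 0 ≤ J k := fun k => integral_nonneg fun y => by positivity
  set s : ℝ := Module.finrank ℝ E + q - 2 with hs
  have hs0 : 0 ≤ s := by
    have := (Module.finrank ℝ E).cast_nonneg (α := ℝ)
    rw [hs]; linarith
  have hrec : M * J q ≤ s * J (q - 2) + β * J (q - 1) := by
    have h1 := div_le_div_of_nonneg_right (moment_recursion hint h hq) hZ0.le
    rw [add_div, mul_div_assoc, mul_div_assoc, mul_div_assoc, ← hJ, ← hJ, ← hJ] at h1
    exact h1
  have hq0 : 0 < q := by linarith
  set x : ℝ := J q ^ (1 / q) with hx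
  have hx0 : 0 ≤ x := Real.rpow_nonneg (hJ0 q) _
  have hxq : J q = x ^ q := by
    rw [hx, ← Real.rpow_mul (hJ0 q), one_div, inv_mul_cancel₀ hq0.ne', Real.rpow_one]
  -- Lyapunov's inequality, by Jensen for the concave power `k / q`; it closes the recursion in
  -- terms of the `L^q` norm `x` alone.
  have hlyap : ∀ k : ℝ, 0 ≤ k → k ≤ q → J k ≤ x ^ k := by
    intro k hk hkq
    have hc := Real.concaveOn_rpow (p := k / q) (by positivity) ((div_le_one hq0).2 hkq)
    have hkq' : ∀ y : E, (‖y‖ ^ q) ^ (k / q) = ‖y‖ ^ k := fun y => by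
      rw [← Real.rpow_mul (norm_nonneg y)]
      congr 1
      field_simp
    have h1 := hc.le_map_integral (μ := μ) (f := fun y => ‖y‖ ^ q)
      (fun t ht => (Real.continuousAt_rpow_const t _ (Or.inr (by positivity))).continuousWithinAt)
      isClosed_Ici (Eventually.of_forall fun y => Set.mem_Ici.2 (by positivity))
      (hJi q hq0.le) (by simpa [Function.comp_def, hkq'] using hJi k hk)
    simp only [hkq'] at h1
    refine h1.trans (le_of_eq ?_)
    change J q ^ (k / q) = x ^ k
    rw [hx, ← Real.rpow_mul (hJ0 q)]
    congr 1
    ring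
  have hx2 : x ^ 2 ≤ 2 * s / M + β ^ 2 / M ^ 2 := by
    rcases hx0.eq_or_lt with h0 | h0
    · rw [← h0, zero_pow two_ne_zero]
      positivity
    · have e1 : x ^ q = x ^ (q - 2) * x ^ 2 := by
        rw [← Real.rpow_natCast, ← Real.rpow_add h0]; congr 1; push_cast; ring
      have e2 : x ^ (q - 1) = x ^ (q - 2) * x := by
        conv_rhs => rw [← Real.rpow_one x, ← Real.rpow_mul hx0, one_mul, ← Real.rpow_add h0]
        congr 1; ring
      have h1 : x ^ (q - 2) * (M * x ^ 2) ≤ x ^ (q - 2) * (s + β * x) := by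
        calc x ^ (q - 2) * (M * x ^ 2) = M * J q := by rw [hxq, e1]; ring
          _ ≤ s * J (q - 2) + β * J (q - 1) := hrec
          _ ≤ s * x ^ (q - 2) + β * x ^ (q - 1) := by
            gcongr
            · exact hlyap _ (by linarith) (by linarith)
            · exact hlyap _ (by linarith) (by linarith)
          _ = _ := by rw [e2]; ring
      have h2 : M * x ^ 2 ≤ s + β * x := le_of_mul_le_mul_left h1 (by positivity)
      -- Young's inequality `β x ≤ β² / (2 M) + M x² / 2`, written as a completed square.
      have h3 : 2 * s / M + β ^ 2 / M ^ 2 - x ^ 2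
          = (2 * (s + β * x - M * x ^ 2) * M + (β - M * x) ^ 2) / M ^ 2 := by
        field_simp
        ring
      have h4 : 0 ≤ 2 * s / M + β ^ 2 / M ^ 2 - x ^ 2 := by
        rw [h3]
        have := sub_nonneg.2 h2
        positivity
      linarith
  rw [← ofReal_integral_eq_lintegral_ofReal (hJi q hq0.le)
    (Eventually.of_forall fun y => by positivity)]
  refine ENNReal.ofReal_le_ofReal ?_
  calc J q = (x ^ 2) ^ (q / 2) := by
        rw [hxq, ← Real.rpow_natCast, ← Real.rpow_mul hx0]; congr 1; push_cast; ring
    _ ≤ _ := by gcongr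

end TiltedMoments

/-! ### Minkowski's inequality and tails from moments -/

section MomentTools

variable {Ω : Type*} [MeasurableSpace Ω] {P : Measure Ω} [IsProbabilityMeasure P]

/-- Minkowski's inequality for a constant plus a sum of nonnegative random variables with equal
moment bounds. -/
theorem lintegral_rpow_const_add_sum_le {ι : Type*} [Fintype ι] {f : ι → Ω → ℝ}
    (hfm : ∀ j, Measurable (f j)) (hf0 : ∀ j ω, 0 ≤ f j ω) {A B s : ℝ} (hA : 0 ≤ A) (hB : 0 ≤ B)
    (hs : 1 ≤ s) (h : ∀ j, ∫⁻ ω, ENNReal.ofReal (f j ω ^ s) ∂P ≤ ENNReal.ofReal (B ^ s)) :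
    ∫⁻ ω, ENNReal.ofReal ((A + ∑ j, f j ω) ^ s) ∂P
      ≤ ENNReal.ofReal ((A + Fintype.card ι * B) ^ s) := by
  have hs0 : 0 < s := by linarith
  have hnorm : ∀ g : Ω → ℝ, (∀ ω, 0 ≤ g ω) →
      eLpNorm' g s P = (∫⁻ ω, ENNReal.ofReal (g ω ^ s) ∂P) ^ (1 / s) := by
    intro g hg
    rw [eLpNorm'_eq_lintegral_enorm]
    congr 1
    refine lintegral_congr fun ω => ?_
    rw [Real.enorm_eq_ofReal (hg ω), ENNReal.ofReal_rpow_of_nonneg (hg ω) hs0.le]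
  have hroot : ∀ b : ℝ, 0 ≤ b → (ENNReal.ofReal (b ^ s)) ^ (1 / s) = ENNReal.ofReal b := by
    intro b hb
    rw [ENNReal.ofReal_rpow_of_nonneg (by positivity) (by positivity), ← Real.rpow_mul hb,
      mul_one_div_cancel hs0.ne', Real.rpow_one]
  have h1 : eLpNorm' (fun ω => A + ∑ j, f j ω) s P
      ≤ ENNReal.ofReal (A + Fintype.card ι * B) := by
    have e : (fun ω => A + ∑ j, f j ω) = (fun _ => A) + ∑ j, f j := by
      ext ω; simp
    have hsum : AEStronglyMeasurable (∑ j, f j) P :=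
      Finset.aestronglyMeasurable_sum _ fun j _ => (hfm j).aestronglyMeasurable
    rw [e]
    calc _ ≤ eLpNorm' (fun _ => A) s P + eLpNorm' (∑ j, f j) s P :=
          eLpNorm'_add_le aestronglyMeasurable_const hsum hs
      _ ≤ ENNReal.ofReal A + ∑ _j : ι, ENNReal.ofReal B := by
          refine add_le_add ?_ ((eLpNorm'_sum_le
            (fun j _ => (hfm j).aestronglyMeasurable) hs).trans (Finset.sum_le_sum fun j _ => ?_))
          · rw [hnorm _ fun _ => hA, lintegral_const, measure_univ, mul_one, hroot A hA]
          · rw [hnorm _ (hf0 j), ← hroot B hB]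
            exact ENNReal.rpow_le_rpow (h j) (by positivity)
      _ = _ := by
          rw [Finset.sum_const, Finset.card_univ, nsmul_eq_mul,
            ENNReal.ofReal_add hA (by positivity), ENNReal.ofReal_mul (by positivity),
            ENNReal.ofReal_natCast]
  rw [hnorm _ fun ω => add_nonneg hA (Finset.sum_nonneg fun j _ => hf0 j ω),
    ← hroot _ (by positivity)] at h1
  exact (ENNReal.rpow_le_rpow_iff (by positivity)).1 h1

theorem lintegral_rpow_rpow_le_of_exponent_le {Z : Ω → ℝ} (hZ : Measurable Z)
    (hZ0 : ∀ ω, 0 ≤ Z ω) {q r : ℝ} (hq : 0 < q) (hqr : q ≤ r) :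
    (∫⁻ ω, ENNReal.ofReal (Z ω ^ q) ∂P) ^ (1 / q)
      ≤ (∫⁻ ω, ENNReal.ofReal (Z ω ^ r) ∂P) ^ (1 / r) := by
  have hnorm : ∀ s : ℝ, 0 < s →
      eLpNorm' Z s P = (∫⁻ ω, ENNReal.ofReal (Z ω ^ s) ∂P) ^ (1 / s) := by
    intro s hs
    rw [eLpNorm'_eq_lintegral_enorm]
    congr 1
    refine lintegral_congr fun ω => ?_
    rw [Real.enorm_eq_ofReal (hZ0 ω), ENNReal.ofReal_rpow_of_nonneg (hZ0 ω) hs.le]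
  rw [← hnorm q hq, ← hnorm r (hq.trans_le hqr)]
  exact eLpNorm'_le_eLpNorm'_of_exponent_le hq hqr P hZ.aestronglyMeasurable

/-- Moments growing like `√q` give sub-Gaussian tails. -/
theorem hasSubGaussianTails_of_moments {Z : Ω → ℝ} (hZ : Measurable Z)
    {C : ℝ} (hC : 0 < C)
    (h : ∀ q : ℝ, 1 ≤ q → (∫⁻ ω, ENNReal.ofReal (Z ω ^ q) ∂P) ^ (1 / q)
      ≤ ENNReal.ofReal (√(C * q))) :
    HasSubGaussianTails P Z := by
  have hD : 0 < Real.exp 1 * C := by positivity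
  refine ⟨√(2 * (Real.exp 1 * C)), Real.sqrt_pos.2 (by positivity), fun t ht => ?_⟩
  rw [Real.sq_sqrt (by positivity)]
  -- The exponent minimizing Markov's bound `(C q / t²) ^ (q / 2)`, with value `exp (-q / 2)`. If it
  -- falls below `1`, the prefactor `2` makes the claim trivial.
  set q : ℝ := t ^ 2 / (Real.exp 1 * C) with hq
  have he : -t ^ 2 / (2 * (Real.exp 1 * C)) = -(q / 2) := by
    rw [hq]; field_simp
  rw [he]
  rcases lt_or_ge q 1 with hq1 | hq1
  · refine prob_le_one.trans ?_
    rw [← ENNReal.ofReal_one]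
    refine ENNReal.ofReal_le_ofReal ?_
    linarith [Real.add_one_le_exp (-(q / 2))]
  · have hq0 : 0 < q := by linarith
    have ht0 : 0 < t := by
      rcases ht.eq_or_lt with h0 | h0
      · rw [← h0] at hq; simp at hq; linarith
      · exact h0
    have hmom : ∫⁻ ω, ENNReal.ofReal (Z ω ^ q) ∂P ≤ ENNReal.ofReal (√(C * q) ^ q) := by
      have h1 := ENNReal.rpow_le_rpow (h q hq1) hq0.le
      rwa [← ENNReal.rpow_mul, one_div, inv_mul_cancel₀ hq0.ne', ENNReal.rpow_one,
        ENNReal.ofReal_rpow_of_nonneg (Real.sqrt_nonneg _) hq0.le] at h1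
    have hval : √(C * q) ^ q = t ^ q * Real.exp (-(q / 2)) := by
      have e1 : C * q = t ^ 2 * Real.exp (-1) := by
        rw [hq, Real.exp_neg]; field_simp
      rw [e1, Real.sqrt_mul (by positivity), Real.sqrt_sq ht,
        Real.mul_rpow ht (Real.sqrt_nonneg _), Real.sqrt_eq_rpow, ← Real.exp_mul, ← Real.exp_mul]
      congr 2
      ring
    have hmarkov := mul_meas_ge_le_lintegral (μ := P)
      (f := fun ω => ENNReal.ofReal (Z ω ^ q)) (by fun_prop) (ENNReal.ofReal (t ^ q))
    have hsub : P {ω | t ≤ Z ω} ≤ P {ω | ENNReal.ofReal (t ^ q) ≤ ENNReal.ofReal (Z ω ^ q)} :=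
      measure_mono fun ω hω => ENNReal.ofReal_le_ofReal (Real.rpow_le_rpow ht hω hq0.le)
    have htq : 0 < t ^ q := by positivity
    have hfin : ENNReal.ofReal (t ^ q) * P {ω | t ≤ Z ω}
        ≤ ENNReal.ofReal (t ^ q) * ENNReal.ofReal (Real.exp (-(q / 2))) := by
      rw [← ENNReal.ofReal_mul htq.le, ← hval]
      exact (mul_le_mul_right hsub _).trans (hmarkov.trans hmom)
    refine ((ENNReal.mul_le_mul_iff_right (by simpa using htq) ENNReal.ofReal_ne_top).1
      hfin).trans (ENNReal.ofReal_le_ofReal ?_)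
    linarith [Real.exp_pos (-(q / 2))]

end MomentTools

/-! ### The sample score and the posterior -/

section Posterior

variable {d : ℕ} {p : ℝ → EuclideanSpace ℝ (Fin d) → ℝ} {m ν L : ℝ}
  {θs : EuclideanSpace ℝ (Fin d)} {T : ℕ}

theorem JointLipschitzGrad.nonneg (hL : JointLipschitzGrad p L) : 0 ≤ L := by
  have := (norm_nonneg _).trans (hL 1 0 0 0)
  simpa using this

theorem IsDensityFamily.rewardLaw_eq (hp : IsDensityFamily p) (θ : EuclideanSpace ℝ (Fin d)) :
    rewardLaw p θ
      = volume.withDensity fun x => ENNReal.ofReal (Real.exp (Real.log (p x θ))) := by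
  simp_rw [rewardLaw, Real.exp_log (hp.pos _ _)]

theorem IsDensityFamily.isProbabilityMeasure (hp : IsDensityFamily p)
    (θ : EuclideanSpace ℝ (Fin d)) : IsProbabilityMeasure (rewardLaw p θ) :=
  ⟨by rw [rewardLaw, withDensity_apply _ MeasurableSet.univ, Measure.restrict_univ,
    hp.lintegral_eq_one]⟩

theorem IsDensityFamily.measurable (hp : IsDensityFamily p) (hX : StronglyLogConcaveReward p ν)
    (θ : EuclideanSpace ℝ (Fin d)) : Measurable fun x => p x θ := by
  have := Real.measurable_exp.comp (hX.differentiable θ).continuous.measurable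
  simpa [Function.comp_def, Real.exp_log (hp.pos _ _)] using this

theorem rewardLaw_cosh_sub_le (hp : IsDensityFamily p) (hν : 0 < ν)
    (hX : StronglyLogConcaveReward p ν) (θ : EuclideanSpace ℝ (Fin d)) (s : ℝ) :
    ∫⁻ x, ∫⁻ x', ENNReal.ofReal (Real.cosh (s * (x - x'))) ∂(rewardLaw p θ) ∂(rewardLaw p θ)
      ≤ ENNReal.ofReal (Real.exp (s ^ 2 / ν)) := by
  have := hp.isProbabilityMeasure θ
  exact lintegral_lintegral_cosh_sub_le hν (hX.differentiable θ)
    (fun x x' => hX.mul_le x x' θ) _ (hp.rewardLaw_eq θ) s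

theorem JointLipschitzGrad.continuous_gradParam (hL : JointLipschitzGrad p L)
    (θ : EuclideanSpace ℝ (Fin d)) : Continuous fun x => gradParam p x θ := by
  refine (LipschitzWith.of_dist_le_mul (K := ⟨L, hL.nonneg⟩) fun x x' => ?_).continuous
  have := hL x x' θ θ
  rw [sub_self, norm_zero, add_zero] at this
  rwa [dist_eq_norm, Real.dist_eq]

theorem JointLipschitzGrad.abs_inner_sub_le (hL : JointLipschitzGrad p L)
    (θ v : EuclideanSpace ℝ (Fin d)) (x x' : ℝ) :
    |inner ℝ (gradParam p x θ) v - inner ℝ (gradParam p x' θ) v| ≤ L * ‖v‖ * |x - x'| := by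
  have h := hL x x' θ θ
  rw [sub_self, norm_zero, add_zero] at h
  rw [← inner_sub_left]
  calc _ ≤ ‖gradParam p x θ - gradParam p x' θ‖ * ‖v‖ := abs_real_inner_le_norm _ _
    _ ≤ L * |x - x'| * ‖v‖ := by gcongr
    _ = _ := by ring

theorem integrable_inner_gradParam (hp : IsDensityFamily p) (hν : 0 < ν)
    (hX : StronglyLogConcaveReward p ν) (hL : JointLipschitzGrad p L)
    (θ v : EuclideanSpace ℝ (Fin d)) :
    Integrable (fun x => inner ℝ (gradParam p x θ) v) (rewardLaw p θ) := by
  have := hp.isProbabilityMeasure θ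
  exact integrable_of_cosh_sub_le (rewardLaw_cosh_sub_le hp hν hX θ)
    ((hL.continuous_gradParam θ).inner continuous_const).measurable (hL.abs_inner_sub_le θ v)

/-- The score has mean zero. -/
theorem integral_inner_gradParam_eq_zero (hp : IsDensityFamily p)
    (hθ : StronglyLogConcaveParam p m) (hν : 0 < ν)
    (hX : StronglyLogConcaveReward p ν) (hL : JointLipschitzGrad p L)
    (θ v : EuclideanSpace ℝ (Fin d)) :
    ∫ x, inner ℝ (gradParam p x θ) v ∂(rewardLaw p θ) = 0 := by
  have := hp.isProbabilityMeasure θ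
  have hnonpos : ∀ w : EuclideanSpace ℝ (Fin d),
      ∫ x, inner ℝ (gradParam p x θ) w ∂(rewardLaw p θ) ≤ 0 := by
    intro w
    have hi := integrable_inner_gradParam hp hν hX hL θ w
    set c : ℝ := L * ‖w‖ ^ 2 with hc
    -- The likelihood ratio `p x (θ + t • w) / p x θ` has mean one and is at least `1` plus its
    -- logarithm, hence at least `1 + t ⟨score, w⟩ - t² c`. This avoids differentiating under the
    -- integral; `w = ± v` then gives equality.
    have key : ∀ t : ℝ, 0 < t →
        ∫ x, inner ℝ (gradParam p x θ) w ∂(rewardLaw p θ) ≤ t * c := by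
      intro t ht
      have hint : Integrable (fun x => 1 + (t * inner ℝ (gradParam p x θ) w - t ^ 2 * c))
          (rewardLaw p θ) :=
        (integrable_const _).add ((hi.const_mul t).sub (integrable_const _))
      have hle : ENNReal.ofReal (∫ x, (1 + (t * inner ℝ (gradParam p x θ) w - t ^ 2 * c))
          ∂(rewardLaw p θ)) ≤ ENNReal.ofReal 1 := by
        refine (ofReal_integral_le_lintegral_ofReal hint).trans ?_
        calc _ ≤ ∫⁻ x, ENNReal.ofReal (p x (θ + t • w) / p x θ) ∂(rewardLaw p θ) := by
              refine lintegral_mono fun x => ENNReal.ofReal_le_ofReal ?_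
              have hlip : ∀ a b, ‖gradParam p x a - gradParam p x b‖ ≤ L * ‖a - b‖ := fun a b => by
                simpa using hL x x a b
              have h1 := le_sub_of_lipschitz_gradient (hθ.differentiable x) hL.nonneg hlip θ w ht
              have h2 := Real.add_one_le_exp (Real.log (p x (θ + t • w)) - Real.log (p x θ))
              rw [Real.exp_sub, Real.exp_log (hp.pos _ _), Real.exp_log (hp.pos _ _)] at h2
              refine le_trans ?_ h2
              have h3 : t * inner ℝ (gradParam p x θ) w - t ^ 2 * c
                ≤ Real.log (p x (θ + t • w)) - Real.log (p x θ) := h1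
              linarith
          _ = ∫⁻ x, ENNReal.ofReal (p x (θ + t • w)) := by
              have hm := hp.measurable hX
              have hdiv : Measurable fun x => ENNReal.ofReal (p x (θ + t • w) / p x θ) :=
                ((hm (θ + t • w)).div (hm θ)).ennreal_ofReal
              rw [rewardLaw, lintegral_withDensity_eq_lintegral_mul _ (hm θ).ennreal_ofReal hdiv]
              refine lintegral_congr fun x => ?_
              rw [Pi.mul_apply, ← ENNReal.ofReal_mul (hp.pos _ _).le,
                mul_div_cancel₀ _ (hp.pos _ _).ne']
          _ = ENNReal.ofReal 1 := by rw [hp.lintegral_eq_one, ENNReal.ofReal_one]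
      have hint' : Integrable (fun x => t * inner ℝ (gradParam p x θ) w - t ^ 2 * c)
          (rewardLaw p θ) := (hi.const_mul t).sub (integrable_const _)
      rw [ENNReal.ofReal_le_ofReal_iff zero_le_one, integral_add (integrable_const _) hint',
        integral_sub (hi.const_mul t)
        (integrable_const _), integral_const_mul] at hle
      simp only [integral_const, probReal_univ, smul_eq_mul, one_mul] at hle
      refine le_of_mul_le_mul_left ?_ ht
      linarith
    have hlim : Tendsto (fun t : ℝ => t * c) (𝓝[>] 0) (𝓝 (0 * c)) :=
      (Continuous.tendsto (by fun_prop) 0).mono_left nhdsWithin_le_nhds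
    rw [zero_mul] at hlim
    exact ge_of_tendsto hlim (by
      filter_upwards [self_mem_nhdsWithin] with t ht
      exact key t ht)
  refine le_antisymm (hnonpos v) ?_
  have h := hnonpos (-v)
  simp only [inner_neg_right, integral_neg] at h
  linarith

/-- The score of the whole sample. -/
noncomputable def sampleScore (p : ℝ → EuclideanSpace ℝ (Fin d) → ℝ) (θ : EuclideanSpace ℝ (Fin d))
    (X : Fin T → ℝ) : EuclideanSpace ℝ (Fin d) :=
  ∑ i, gradParam p (X i) θ

theorem measurable_sampleScore_apply (hL : JointLipschitzGrad p L) (j : Fin d) :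
    Measurable fun X : Fin T → ℝ => sampleScore p θs X j := by
  have hc : Continuous fun X : Fin T → ℝ => sampleScore p θs X :=
    continuous_finsetSum _ fun i _ => (hL.continuous_gradParam θs).comp (continuous_apply i)
  exact ((EuclideanSpace.proj (𝕜 := ℝ) j).continuous.comp hc).measurable

theorem sampleScore_mgf_le (hp : IsDensityFamily p)
    (hθ : StronglyLogConcaveParam p m) (hν : 0 < ν)
    (hX : StronglyLogConcaveReward p ν) (hL : JointLipschitzGrad p L) (j : Fin d) (t : ℝ) :
    Integrable (fun X : Fin T → ℝ => Real.exp (t * sampleScore p θs X j)) (dataLaw p θs T) ∧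
      ∫ X : Fin T → ℝ, Real.exp (t * sampleScore p θs X j) ∂(dataLaw p θs T)
        ≤ Real.exp (t ^ 2 * (T * L ^ 2 / ν)) := by
  have := hp.isProbabilityMeasure θs
  set v : EuclideanSpace ℝ (Fin d) := EuclideanSpace.single j 1 with hv
  have hvn : ‖v‖ = 1 := by simp [hv]
  have hS : ∀ X : Fin T → ℝ,
      sampleScore p θs X j = ∑ i, inner ℝ (gradParam p (X i) θs) v := by
    intro X
    rw [← sum_inner, hv, EuclideanSpace.inner_single_right]
    simp [sampleScore]
  have hm : Measurable fun x => inner ℝ (gradParam p x θs) v :=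
    ((hL.continuous_gradParam θs).inner continuous_const).measurable
  have h := exp_sum_integrable_and_le hm (lintegral_exp_le_of_cosh_sub_le
    (rewardLaw_cosh_sub_le hp hν hX θs) hm (hL.abs_inner_sub_le θs v)
    (integral_inner_gradParam_eq_zero hp hθ hν hX hL θs v) t) T
  simp_rw [hS]
  rw [hvn, mul_one] at h
  refine ⟨h.1, h.2.trans (le_of_eq ?_)⟩
  congr 1
  ring

/-- Both hypotheses are tested on a unit vector, so a coordinate `j` must exist. It is used to get
`0 < L`. -/
theorem StronglyLogConcaveParam.le_lipschitz (hθ : StronglyLogConcaveParam p m)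
    (hL : JointLipschitzGrad p L) (j : Fin d) : m ≤ L := by
  set v : EuclideanSpace ℝ (Fin d) := EuclideanSpace.single j 1 with hv
  have hvn : ‖v‖ = 1 := by simp [hv]
  have h1 := hθ.inner_le 0 v 0
  have h2 := hL 0 0 v 0
  have h3 := neg_le_of_abs_le
    (abs_real_inner_le_norm (gradParam p 0 v - gradParam p 0 0) (v - 0))
  simp only [sub_zero, hvn, abs_zero, zero_add, mul_one, sub_self] at h1 h2 h3
  linarith

/-- Moments of the coordinates of the sample score; the exponent is `max q 2` so as to cover the
range `1 ≤ q < 2` by the second moment. -/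
theorem lintegral_abs_sampleScore_rpow_le (hp : IsDensityFamily p)
    (hθ : StronglyLogConcaveParam p m) (hm : 0 < m) (hν : 0 < ν)
    (hX : StronglyLogConcaveReward p ν) (hL : JointLipschitzGrad p L) (hT : 0 < T)
    (j : Fin d) {q : ℝ} (hq : 1 ≤ q) :
    ∫⁻ X : Fin T → ℝ, ENNReal.ofReal (|sampleScore p θs X j| ^ max q 2) ∂(dataLaw p θs T)
      ≤ ENNReal.ofReal ((2 * (T * L ^ 2 / ν) * q) ^ (max q 2 / 2)) := by
  have := hp.isProbabilityMeasure θs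
  have hprob : IsProbabilityMeasure (dataLaw p θs T) := by unfold dataLaw; infer_instance
  have hL0 : 0 < L := hm.trans_le (hθ.le_lipschitz hL j)
  have hτ : 0 < T * L ^ 2 / ν := by positivity
  have hmgf := fun t => sampleScore_mgf_le (θs := θs) (T := T) hp hθ hν hX hL j t
  rcases le_total 2 q with h2 | h2
  · rw [max_eq_left h2]
    exact lintegral_rpow_abs_le_of_mgf_le hτ hmgf h2
  · rw [max_eq_right h2, div_self two_ne_zero, Real.rpow_one]
    simp only [Real.rpow_ofNat, sq_abs]
    refine (lintegral_sq_le_of_mgf_le (measurable_sampleScore_apply hL j) hmgf).trans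
      (ENNReal.ofReal_le_ofReal ?_)
    exact le_mul_of_one_le_right (by positivity) hq

/-- The single-sample bounds add up to strong concavity `m T` with the sample score as gradient: the
input required by `moment_recursion`. -/
theorem logLikelihood_sub_le (hθ : StronglyLogConcaveParam p m) (hm : 0 < m)
    (X : Fin T → ℝ) (y : EuclideanSpace ℝ (Fin d)) {r : ℝ} (hr0 : 0 ≤ r) (hr1 : r < 1) :
    ∑ i, Real.log (p (X i) (θs + y)) - ∑ i, Real.log (p (X i) (θs + r • y))
      ≤ (1 - r) * (‖sampleScore p θs X‖ * ‖y‖ - m * T * r * ‖y‖ ^ 2) := by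
  rw [← Finset.sum_sub_distrib]
  calc _ ≤ ∑ i, (1 - r) * (inner ℝ (gradParam p (X i) θs) y - m * r * ‖y‖ ^ 2) :=
        Finset.sum_le_sum fun i _ => sub_le_of_strongly_concave (hθ.differentiable (X i)) hm.le
          (hθ.inner_le (X i)) θs y hr0 hr1
    _ = (1 - r) * (inner ℝ (sampleScore p θs X) y - m * T * r * ‖y‖ ^ 2) := by
        rw [← Finset.mul_sum, Finset.sum_sub_distrib, sampleScore, sum_inner]
        simp only [Finset.sum_const, Finset.card_univ, Fintype.card_fin, nsmul_eq_mul]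
        ring
    _ ≤ _ := by
        have := real_inner_le_norm (sampleScore p θs X) y
        have hr : 0 ≤ 1 - r := by linarith
        gcongr

theorem continuous_logLikelihood (hθ : StronglyLogConcaveParam p m) (X : Fin T → ℝ) :
    Continuous fun θ => ∑ i, Real.log (p (X i) θ) :=
  continuous_finsetSum _ fun i _ => (hθ.differentiable (X i)).continuous

theorem integrable_rpow_norm_mul_likelihood (hθ : StronglyLogConcaveParam p m) (hm : 0 < m)
    (hT : 0 < T) (θs : EuclideanSpace ℝ (Fin d)) (X : Fin T → ℝ) {k : ℝ} (hk : 0 ≤ k) :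
    Integrable fun y => ‖y‖ ^ k * Real.exp (∑ i, Real.log (p (X i) (θs + y))) := by
  have hT' : (0 : ℝ) < T := by exact_mod_cast hT
  -- The choice `r = 0` alone loses the quadratic term; going from `y` to `y / 2` with `r = 1 / 2`,
  -- then to `0`, retains `m T / 4`.
  refine integrable_rpow_norm_mul_exp (β := ‖sampleScore p θs X‖) (M := m * T / 4)
    (C := ∑ i, Real.log (p (X i) θs))
    ((continuous_logLikelihood hθ X).comp (continuous_const.add continuous_id))
    (by positivity) (fun y => ?_) hk
  have h1 := logLikelihood_sub_le (θs := θs) hθ hm X y (r := 1 / 2) (by norm_num) (by norm_num)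
  have h2 := logLikelihood_sub_le (θs := θs) hθ hm X ((1 / 2 : ℝ) • y) (r := 0) le_rfl one_pos
  rw [zero_smul, add_zero, norm_smul] at h2
  norm_num at h1 h2 ⊢
  linarith

theorem integrable_likelihood (hθ : StronglyLogConcaveParam p m) (hm : 0 < m)
    (hT : 0 < T) (X : Fin T → ℝ) :
    Integrable fun θ => Real.exp (∑ i, Real.log (p (X i) θ)) := by
  simpa using integrable_rpow_norm_mul_likelihood hθ hm hT 0 X le_rfl

theorem isProbabilityMeasure_targetPosterior (hθ : StronglyLogConcaveParam p m) (hm : 0 < m)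
    (hT : 0 < T) (X : Fin T → ℝ) : IsProbabilityMeasure (targetPosterior p X) :=
  isProbabilityMeasure_tilted (integrable_likelihood hθ hm hT X)

/-- Continuity in `θ` and measurability in `x` make the log-density jointly measurable
(Carathéodory); the rest is measurability of parametric integrals. -/
theorem measurable_targetPosterior (hθ : StronglyLogConcaveParam p m)
    (hX : StronglyLogConcaveReward p ν) :
    Measurable fun X : Fin T → ℝ => targetPosterior p X := by
  have hjoint : Measurable
      (Function.uncurry fun (θ : EuclideanSpace ℝ (Fin d)) (x : ℝ) => Real.log (p x θ)) :=
    measurable_uncurry_of_continuous_of_measurable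
      (fun x => (hθ.differentiable x).continuous)
      (fun θ => (hX.differentiable θ).continuous.measurable)
  have hl : Measurable fun z : (Fin T → ℝ) × EuclideanSpace ℝ (Fin d) =>
      Real.exp (∑ i, Real.log (p (z.1 i) z.2)) := by
    refine Real.measurable_exp.comp (Finset.measurable_sum _ fun i _ => ?_)
    exact hjoint.comp (measurable_snd.prodMk ((measurable_pi_apply i).comp measurable_fst))
  have hZ : Measurable fun X : Fin T → ℝ =>
      ∫ θ : EuclideanSpace ℝ (Fin d), Real.exp (∑ i, Real.log (p (X i) θ)) :=
    hl.stronglyMeasurable.integral_prod_right.measurable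
  refine Measure.measurable_of_measurable_coe _ fun s hs => ?_
  simp_rw [targetPosterior, tilted_apply' _ _ hs]
  have hq : Measurable fun z : (Fin T → ℝ) × EuclideanSpace ℝ (Fin d) =>
      ENNReal.ofReal (Real.exp (∑ i, Real.log (p (z.1 i) z.2)) /
        ∫ θ : EuclideanSpace ℝ (Fin d), Real.exp (∑ i, Real.log (p (z.1 i) θ))) :=
    (hl.div (hZ.comp measurable_fst)).ennreal_ofReal
  exact hq.lintegral_prod_right'

/-- Moments of the posterior for given data. -/
theorem lintegral_rpow_targetPosterior_le (hθ : StronglyLogConcaveParam p m) (hm : 0 < m)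
    (hT : 0 < T) (X : Fin T → ℝ) {q : ℝ} (hq : 2 ≤ q) :
    ∫⁻ θ, ENNReal.ofReal (‖θ - θs‖ ^ q) ∂(targetPosterior p X)
      ≤ ENNReal.ofReal ((2 * (d + q - 2) / (m * T)
        + ‖sampleScore p θs X‖ ^ 2 / (m * T) ^ 2) ^ (q / 2)) := by
  have hT' : (0 : ℝ) < T := by exact_mod_cast hT
  have h := lintegral_rpow_norm_tilted_le (E := EuclideanSpace ℝ (Fin d))
    (W := fun y => ∑ i, Real.log (p (X i) (θs + y)))
    (β := ‖sampleScore p θs X‖) (M := m * T) (by positivity)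
    (fun k hk => integrable_rpow_norm_mul_likelihood hθ hm hT θs X hk)
    (fun r hr0 hr1 y => logLikelihood_sub_le hθ hm X y hr0.le hr1) (norm_nonneg _) hq
  rw [finrank_euclideanSpace_fin] at h
  refine le_trans (le_of_eq ?_) h
  rw [targetPosterior, lintegral_tilted, lintegral_tilted,
    integral_add_left_eq_self (fun y => Real.exp (∑ i, Real.log (p (X i) y))) θs,
    ← lintegral_add_left_eq_self _ θs]
  simp only [add_sub_cancel_left]

/-- Moments of the joint law of data and posterior sample. -/
theorem lintegral_rpow_posteriorLaw_le (hp : IsDensityFamily p)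
    (hθ : StronglyLogConcaveParam p m) (hm : 0 < m) (hν : 0 < ν)
    (hX : StronglyLogConcaveReward p ν) (hL : JointLipschitzGrad p L) (hT : 0 < T)
    {q : ℝ} (hq : 1 ≤ q) :
    ∫⁻ θ, ENNReal.ofReal (‖θ - θs‖ ^ max q 2) ∂(posteriorLaw p θs T)
      ≤ ENNReal.ofReal ((2 * (d + max q 2 - 2) / (m * T)
        + d * (2 * (T * L ^ 2 / ν) * q / (m * T) ^ 2)) ^ (max q 2 / 2)) := by
  have := hp.isProbabilityMeasure θs
  have hprob : IsProbabilityMeasure (dataLaw p θs T) := by unfold dataLaw; infer_instance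
  have hT' : (0 : ℝ) < T := by exact_mod_cast hT
  have h2 : 2 ≤ max q 2 := le_max_right _ _
  set r : ℝ := max q 2 with hr
  have hA : 0 ≤ 2 * (d + r - 2) / (m * T) := by
    have : (0 : ℝ) ≤ d + r - 2 := by
      have := d.cast_nonneg (α := ℝ)
      linarith
    positivity
  have hmeas : Measurable fun θ : EuclideanSpace ℝ (Fin d) =>
      ENNReal.ofReal (‖θ - θs‖ ^ r) := by fun_prop
  rw [posteriorLaw, Measure.lintegral_bind (measurable_targetPosterior hθ hX).aemeasurable
    hmeas.aemeasurable]
  refine (lintegral_mono fun X => lintegral_rpow_targetPosterior_le hθ hm hT X h2).trans ?_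
  have hsum : ∀ X : Fin T → ℝ, ‖sampleScore p θs X‖ ^ 2 / (m * T) ^ 2
      = ∑ j, sampleScore p θs X j ^ 2 / (m * T) ^ 2 := by
    intro X
    rw [EuclideanSpace.norm_sq_eq, Finset.sum_div]
    simp
  simp_rw [hsum]
  -- Minkowski's inequality in `L^(r/2)` for the squared coordinates needs `r ≥ 2`, hence the
  -- exponent `max q 2`.
  have := lintegral_rpow_const_add_sum_le (P := dataLaw p θs T)
    (f := fun (j : Fin d) (X : Fin T → ℝ) => sampleScore p θs X j ^ 2 / (m * T) ^ 2)
    (fun j => ((measurable_sampleScore_apply hL j).pow_const 2).div_const _)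
    (fun j X => by positivity) hA (B := 2 * (T * L ^ 2 / ν) * q / (m * T) ^ 2)
    (by positivity) (s := r / 2) (by linarith) (fun j => ?_)
  · simpa using this
  · have hB : (0 : ℝ) ≤ ((m * T) ^ 2)⁻¹ ^ (r / 2) := by positivity
    have hsplit : ∀ a : ℝ, 0 ≤ a →
        (a / (m * T) ^ 2) ^ (r / 2) = ((m * T) ^ 2)⁻¹ ^ (r / 2) * a ^ (r / 2) := by
      intro a ha
      rw [div_eq_mul_inv, mul_comm, Real.mul_rpow (by positivity) ha]
    have hsq : ∀ a : ℝ, (a ^ 2) ^ (r / 2) = |a| ^ r := by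
      intro a
      rw [← sq_abs, ← Real.rpow_natCast, ← Real.rpow_mul (abs_nonneg a)]
      congr 1
      push_cast
      ring
    simp_rw [hsplit _ (sq_nonneg _), hsq]
    rw [hsplit _ (by positivity), ENNReal.ofReal_mul hB]
    simp_rw [ENNReal.ofReal_mul hB]
    have hme : Measurable fun X : Fin T → ℝ =>
        ENNReal.ofReal (|sampleScore p θs X j| ^ r) :=
      ((measurable_sampleScore_apply hL j).abs.pow_const r).ennreal_ofReal
    rw [lintegral_const_mul _ hme]
    gcongr
    exact lintegral_abs_sampleScore_rpow_le hp hθ hm hν hX hL hT j hq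

theorem isProbabilityMeasure_posteriorLaw (hp : IsDensityFamily p)
    (hθ : StronglyLogConcaveParam p m) (hm : 0 < m)
    (hX : StronglyLogConcaveReward p ν) (hT : 0 < T) :
    IsProbabilityMeasure (posteriorLaw p θs T) := by
  have := hp.isProbabilityMeasure θs
  have hprob : IsProbabilityMeasure (dataLaw p θs T) := by unfold dataLaw; infer_instance
  refine ⟨?_⟩
  rw [posteriorLaw, Measure.bind_apply MeasurableSet.univ
    (measurable_targetPosterior hθ hX).aemeasurable]
  have h1 : ∀ X : Fin T → ℝ, targetPosterior p X Set.univ = 1 := fun X =>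
    (isProbabilityMeasure_targetPosterior hθ hm hT X).measure_univ
  simp [h1]

theorem posteriorLaw_moment_le (hp : IsDensityFamily p)
    (hθ : StronglyLogConcaveParam p m) (hm : 0 < m) (hν : 0 < ν)
    (hX : StronglyLogConcaveReward p ν) (hL : JointLipschitzGrad p L) (hT : 0 < T)
    {q : ℝ} (hq : 1 ≤ q) :
    (∫⁻ θ, ENNReal.ofReal (‖θ - θs‖ ^ q) ∂(posteriorLaw p θs T)) ^ (1 / q) ≤
      ENNReal.ofReal (√(8 * d / (m * T) +
        (2 * L ^ 2 * d / (m ^ 2 * ν * T) + 64 / (m * T)) * q)) := by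
  have hT' : (0 : ℝ) < T := by exact_mod_cast hT
  have := isProbabilityMeasure_posteriorLaw (θs := θs) hp hθ hm hX hT
  have h2 : 2 ≤ max q 2 := le_max_right _ _
  have hd := d.cast_nonneg (α := ℝ)
  refine (lintegral_rpow_rpow_le_of_exponent_le (by fun_prop) (fun θ => norm_nonneg _)
    (by linarith) (le_max_left q 2)).trans ?_
  refine (ENNReal.rpow_le_rpow (lintegral_rpow_posteriorLaw_le hp hθ hm hν hX hL hT hq)
    (by positivity)).trans ?_
  have hs : (0 : ℝ) ≤ d + max q 2 - 2 := by linarith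
  rw [ENNReal.ofReal_rpow_of_nonneg (by positivity) (by positivity),
    ← Real.rpow_mul (by positivity)]
  refine ENNReal.ofReal_le_ofReal ?_
  rw [show max q 2 / 2 * (1 / max q 2) = 1 / 2 by field_simp, ← Real.sqrt_eq_rpow]
  refine Real.sqrt_le_sqrt ?_
  have e1 : d * (2 * (T * L ^ 2 / ν) * q / (m * T) ^ 2)
      = 2 * L ^ 2 * d / (m ^ 2 * ν * T) * q := by
    field_simp
  -- The left side is at most `2 (d + q) / (m T)`, so the constants `8` and `64` leave slack; the
  -- data term `e1` is matched exactly.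
  have e2 : 2 * (d + max q 2 - 2) / (m * T) ≤ 8 * d / (m * T) + 64 / (m * T) * q := by
    rw [← mul_div_right_comm, ← add_div]
    have h3 : max q 2 ≤ q + 2 := max_le (by linarith) (by linarith)
    gcongr
    linarith
  rw [e1]
  linarith

end Posterior

/-! ### Assembly of the bounds -/

theorem mainTheorem4 {A : Type*} (d : A → ℕ)
    (p : (a : A) → ℝ → EuclideanSpace ℝ (Fin (d a)) → ℝ)
    (θstar : (a : A) → EuclideanSpace ℝ (Fin (d a)))
    (m ν L : A → ℝ) (T : ℕ) (hT : 0 < T)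
    (hm : ∀ a, 0 < m a) (hν : ∀ a, 0 < ν a)
    (hp : ∀ a, IsDensityFamily (p a))
    (hθ : ∀ a, StronglyLogConcaveParam (p a) (m a))
    (hX : ∀ a, StronglyLogConcaveReward (p a) (ν a))
    (hL : ∀ a, JointLipschitzGrad (p a) (L a))
    (a : A) (κ : ℝ) (hκ : κ = max (L a / m a) (L a / ν a)) :
    -- the target posterior is a well-defined random probability measure
    (∀ X : Fin T → ℝ, IsProbabilityMeasure (targetPosterior (p a) X)) ∧
    Measurable (fun X : Fin T → ℝ => targetPosterior (p a) X) ∧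
    -- moment bounds
    (∀ q : ℝ, 1 ≤ q →
      (∫⁻ θ, ENNReal.ofReal (‖θ - θstar a‖ ^ q) ∂(posteriorLaw (p a) (θstar a) T)) ^ (1 / q) ≤
        ENNReal.ofReal (Real.sqrt
          (8 * d a / (m a * T) +
            (2 * L a ^ 2 * d a / (m a ^ 2 * ν a * T) + 64 / (m a * T)) * q))) ∧
    (∀ q : ℝ, 1 ≤ q →
      (∫⁻ θ, ENNReal.ofReal (‖θ - θstar a‖ ^ q) ∂(posteriorLaw (p a) (θstar a) T)) ^ (1 / q) ≤
        ENNReal.ofReal (Real.sqrt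
          (2 / (m a * T) * (4 * d a + (κ ^ 2 * d a + 32) * q)))) ∧
    -- sub-Gaussian tails
    HasSubGaussianTails (posteriorLaw (p a) (θstar a) T) (fun θ => ‖θ - θstar a‖) := by
  have hT' : (0 : ℝ) < T := by exact_mod_cast hT
  have hma := hm a
  have hνa := hν a
  have hL0 := (hL a).nonneg
  have hbound : ∀ q : ℝ, 1 ≤ q →
      (∫⁻ θ, ENNReal.ofReal (‖θ - θstar a‖ ^ q) ∂(posteriorLaw (p a) (θstar a) T)) ^ (1 / q) ≤
        ENNReal.ofReal (Real.sqrt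
          (8 * d a / (m a * T) +
            (2 * L a ^ 2 * d a / (m a ^ 2 * ν a * T) + 64 / (m a * T)) * q)) :=
    fun q hq => posteriorLaw_moment_le (hp a) (hθ a) hma hνa (hX a) (hL a) hT hq
  refine ⟨fun X => isProbabilityMeasure_targetPosterior (hθ a) hma hT X,
    measurable_targetPosterior (hθ a) (hX a), hbound, fun q hq => ?_, ?_⟩
  · refine (hbound q hq).trans (ENNReal.ofReal_le_ofReal (Real.sqrt_le_sqrt ?_))
    have hκ2 : L a / m a * (L a / ν a) ≤ κ ^ 2 := by
      rw [hκ, sq]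
      exact mul_le_mul (le_max_left _ _) (le_max_right _ _) (by positivity)
        (le_max_of_le_left (by positivity))
    have e1 : 8 * d a / (m a * T) +
        (2 * L a ^ 2 * d a / (m a ^ 2 * ν a * T) + 64 / (m a * T)) * q
        = 2 / (m a * T) * (4 * d a + (L a / m a * (L a / ν a) * d a + 32) * q) := by
      field_simp
      ring
    rw [e1]
    gcongr
  · have := isProbabilityMeasure_posteriorLaw (θs := θstar a) (hp a) (hθ a) hma (hX a) hT
    refine hasSubGaussianTails_of_moments (by fun_prop)
      -- As `q ≥ 1`, the constant term may be multiplied by `q`. The summand `64 / (m a * T)` keeps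
      -- `C` positive even in dimension zero.
      (C := 8 * d a / (m a * T) + (2 * L a ^ 2 * d a / (m a ^ 2 * ν a * T) + 64 / (m a * T)))
      (by positivity) fun q hq => (hbound q hq).trans
        (ENNReal.ofReal_le_ofReal (Real.sqrt_le_sqrt ?_))
    have : 8 * d a / (m a * T) ≤ 8 * d a / (m a * T) * q :=
      le_mul_of_one_le_right (by positivity) hq
    linarith
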